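/- Conventions. For $a,b\ge 0$, $\lambda\in[0,1]$ and $s\in[-\infty,+\infty]$ let $M_s^{\lambda}(a,b)=((1-\lambda)a^s+\lambda b^s)^{1/s}$ if $s\notin\{-\infty,0,+\infty\}$ (with $0^s=+\infty$ and $(+\infty)^{1/s}=0$ for $s<0$, and $0\cdot\infty=0$), $M_0^{\lambda}(a,b)=a^{1-\lambda}b^{\lambda}$, $M_{-\infty}^{\lambda}(a,b)=\min(a,b)$, $M_{+\infty}^{\lambda}(a,b)=\max(a,b)$. A function $f:\mathbb{R}^n\to[0,\infty)$ is $\alpha$-concave if $f((1-\lambda)x+\lambda y)\ge M_\alpha^\lambda(f(x),f(y))$ for all $\lambda\in[0,1]$ and all $x,y$ with $f(x)f(y)>0$. A set or a measure in $\mathbb{R}^n$ is unconditional if it is invariant under all maps $(x_1,\dots,x_n)\mapsto(\varepsilon_1x_1,\dots,\varepsilon_nx_n)$ with $\varepsilon\in\{-1,1\}^n$. A convex body is a compact convex set containing the origin in its interior. For $p\in[0,1]^n$, non-empty $A,B\subset\mathbb{R}^n$ and $\lambda\in[0,1]$, $(1-\lambda)\cdot A+_p\lambda\cdot B$ denotes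 the unconditional set whose intersection with $[0,\infty)^n$ is $$\{(M_{p_1}^{\lambda}(a_1,b_1),\dots,M_{p_n}^{\lambda}(a_n,b_n)) : a\in A\cap[0,\infty)^n,\ b\in B\cap[0,\infty)^n\}.$$ Theorem. Let $p=(p_1,\dots,p_n)\in[0,1]^n$ and let $\alpha\in\mathbb{R}$ satisfy $\alpha\ge-\left(\sum_{i=1}^n p_i^{-1}\right)^{-1}$. Let $\mu$ be an unconditional measure in $\mathbb{R}^n$ that has an $\alpha$-concave density with respect to the Lebesgue measure. Then, for all unconditional convex bodies $A,B$ in $\mathbb{R}^n$ and all $\lambda\in[0,1]$, $$\mu((1-\lambda)\cdot A+_p\lambda\cdot B)\ \ge\ M_\gamma^\lambda(\mu(A),\mu(B)),\qquad \gamma=\Big(\sum_{i=1}^n p_i^{-1}+\alpha^{-1}\Big)^{-1}.$$ Here $0^{-1}=+\infty$ and $(+\infty)^{-1}=0$ (so $\gamma=0$ if $\alpha=0$ or some $p_i=0$), except that $\gamma=-\infty$ in the endpoint case $\alpha=-\left(\sum_{i=1}^n p_i^{-1}\right)^{-1}<0$. -/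

import Mathlib

open MeasureTheory
open scoped NNReal ENNReal

namespace LpBM

/-- The `s`-mean with weight `lam` of two nonnegative numbers, for `s ∈ [-∞, ∞]`. It is computed in
`[0, ∞]`, so that `0 ^ s = ∞` and `∞ ^ (1 / s) = 0` for negative `s`, and `0 * ∞ = 0`. -/
noncomputable def powMean (s : EReal) (lam : ℝ) (a b : ℝ≥0∞) : ℝ≥0∞ :=
  if s = ⊥ then min a b
  else if s = ⊤ then max a b
  else if s = 0 then a ^ (1 - lam) * b ^ lam
  else (ENNReal.ofReal (1 - lam) * a ^ s.toReal + ENNReal.ofReal lam * b ^ s.toReal) ^ (1 / s.toReal)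

/-- Sign vectors, the elements of `{-1, 1}ⁿ`. -/
def IsSign {n : ℕ} (ε : Fin n → ℝ) : Prop := ∀ i, ε i = 1 ∨ ε i = -1

/-- A subset of `ℝⁿ` invariant under all coordinate reflections (with respect to the canonical
basis); `ε * x` is the coordinatewise product. -/
def IsUnconditionalSet {n : ℕ} (A : Set (Fin n → ℝ)) : Prop :=
  ∀ ε : Fin n → ℝ, IsSign ε → ∀ x, ε * x ∈ A ↔ x ∈ A

/-- A measure on `ℝⁿ` invariant under all coordinate reflections. -/
def IsUnconditionalMeasure {n : ℕ} (μ : Measure (Fin n → ℝ)) : Prop :=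
  ∀ ε : Fin n → ℝ, IsSign ε → μ.map (fun x => ε * x) = μ

/-- A convex body: a compact convex set containing the origin in its interior. -/
structure IsConvexBody {n : ℕ} (A : Set (Fin n → ℝ)) : Prop where
  convex : Convex ℝ A
  isCompact : IsCompact A
  zero_mem_interior : (0 : Fin n → ℝ) ∈ interior A

/-- `α`-concavity of a function `f : ℝⁿ → [0, ∞)`, for `α ∈ [-∞, ∞]`. -/
def IsAlphaConcave {n : ℕ} (α : EReal) (f : (Fin n → ℝ) → ℝ≥0) : Prop :=
  ∀ x y, 0 < f x * f y → ∀ lam ∈ Set.Icc (0 : ℝ) 1,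
    powMean α lam (f x) (f y) ≤ f ((1 - lam) • x + lam • y)

/-- `μ` has an `α`-concave density with respect to the Lebesgue measure of `ℝⁿ`. -/
def HasAlphaConcaveDensity {n : ℕ} (α : EReal) (μ : Measure (Fin n → ℝ)) : Prop :=
  ∃ f : (Fin n → ℝ) → ℝ≥0, AEMeasurable f (volume : Measure (Fin n → ℝ)) ∧
    IsAlphaConcave α f ∧ μ = (volume : Measure (Fin n → ℝ)).withDensity (fun x => (f x : ℝ≥0∞))

/-- The coordinatewise mean `(1 - lam) a +_p lam b` of two points of the positive octant. -/
noncomputable def pMeanPoint {n : ℕ} (p : Fin n → EReal) (lam : ℝ) (a b : Fin n → ℝ) :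
    Fin n → ℝ :=
  fun i => (powMean (p i) lam (ENNReal.ofReal (a i)) (ENNReal.ofReal (b i))).toReal

/-- The combination `(1 - lam) · A +_p lam · B`: the unconditional set whose part in the positive
octant consists of the coordinatewise means of points of `A` and of `B` in the positive octant. -/
def pCombination {n : ℕ} (p : Fin n → EReal) (lam : ℝ) (A B : Set (Fin n → ℝ)) :
    Set (Fin n → ℝ) :=
  {x | ∃ a ∈ A, ∃ b ∈ B, 0 ≤ a ∧ 0 ≤ b ∧ (fun i => |x i|) = pMeanPoint p lam a b}

theorem isUnconditionalSet_pCombination {n : ℕ} (p : Fin n → EReal) (lam : ℝ)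
    (A B : Set (Fin n → ℝ)) : IsUnconditionalSet (pCombination p lam A B) := by
  intro ε hε x
  have h : (fun i => |(ε * x) i|) = fun i => |x i| := by
    funext i
    rcases hε i with h | h <;> simp [h]
  simp only [pCombination, Set.mem_ofPred_eq, h]

theorem pCombination_inter_octant {n : ℕ} (p : Fin n → EReal) (lam : ℝ)
    (A B : Set (Fin n → ℝ)) :
    pCombination p lam A B ∩ {x | 0 ≤ x} =
      {x | ∃ a ∈ A ∩ {z | 0 ≤ z}, ∃ b ∈ B ∩ {z | 0 ≤ z}, x = pMeanPoint p lam a b} := by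
  ext x
  constructor
  · rintro ⟨⟨a, ha, b, hb, ha0, hb0, h⟩, hx⟩
    refine ⟨a, ⟨ha, ha0⟩, b, ⟨hb, hb0⟩, ?_⟩
    rw [← h]
    funext i
    exact (abs_of_nonneg (hx i)).symm
  · rintro ⟨a, ⟨ha, ha0⟩, b, ⟨hb, hb0⟩, rfl⟩
    refine ⟨⟨a, ha, b, hb, ha0, hb0, ?_⟩, fun i => ENNReal.toReal_nonneg⟩
    funext i
    exact abs_of_nonneg ENNReal.toReal_nonneg

/-- `∑ i, (p i)⁻¹ ∈ [0, ∞]`, where `0⁻¹ = ∞`. -/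
noncomputable def sumInv {n : ℕ} (p : Fin n → ℝ) : ℝ≥0∞ :=
  ∑ i, (ENNReal.ofReal (p i))⁻¹

/-- The exponent `γ = (∑ i, (p i)⁻¹ + α⁻¹)⁻¹ ∈ [-∞, ∞)`. It is `0` if some `p i` or `α` vanishes
(`0⁻¹ = ∞`, `∞⁻¹ = 0`), and `-∞`, the limit from the right in `α`, at the endpoint
`α = -(∑ i, (p i)⁻¹)⁻¹ < 0`. -/
noncomputable def gammaExp {n : ℕ} (p : Fin n → ℝ) (α : ℝ) : EReal :=
  if sumInv p = ⊤ ∨ α = 0 then 0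
  else if (sumInv p).toReal + α⁻¹ = 0 then ⊥
  else (((sumInv p).toReal + α⁻¹)⁻¹ : ℝ)

end LpBM

/-!
The density of an unconditional measure can be replaced by its smallest value on each orbit of the
coordinate reflections (`signInf`). This version is unconditional and still `α`-concave, so its
superlevel sets are convex and unconditional; hence it is antitone on the positive octant. For the
same reason the parts of `A` and `B` in the octant are lower sets, and so is, by homogeneity of the
means, the part of their combination `C` (`mem_pCombination_of_le`). By unconditionality it
suffices to compare the integrals over the octant of the functions `f`, `g`, `h` obtained by
restricting the density to `A`, `B`, `C`. All three are antitone, and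
`h (M_p(x, y)) ≥ M_α(f x, g y)`, because the coordinatewise mean `M_p(x, y)` lies below the
arithmetic mean.

The inequality is therefore a Borell-Brascamp-Lieb inequality for coordinatewise `p i`-means
(`powMean_lintegral_octant_le`). It is proved by induction on the dimension from its case on the
half-line (`powMean_lintegral_Ioi_le`), each coordinate adding `1 / p i` to the reciprocal of the
exponent of concavity. On the half-line the substitution `x = s ^ (1 / p)`, or `x = exp s`, leads to
the classical inequality on the line (`powMean_lintegral_le`), which follows by comparing superlevel
sets with the one-dimensional Brunn-Minkowski inequality. The change of exponents, both for the
Jacobian and for the integration, is Hölder's inequality for means (`powMean_mul_rpow_le`). If some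
`p i` or `α` is zero then `α ≥ 0` and `γ = 0`, and an `α`-concave density is used only through its
`0`-concavity.
-/

namespace LpBM

open Set Filter Topology
open scoped Pointwise

/-! ### Means of two numbers in `[0, ∞]` -/

theorem powMean_bot (lam : ℝ) (a b : ℝ≥0∞) : powMean ⊥ lam a b = min a b := by
  simp [powMean]

theorem powMean_zero (lam : ℝ) (a b : ℝ≥0∞) :
    powMean 0 lam a b = a ^ (1 - lam) * b ^ lam := by
  simp [powMean]

theorem powMean_coe {s : ℝ} (hs : s ≠ 0) (lam : ℝ) (a b : ℝ≥0∞) :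
    powMean (s : EReal) lam a b =
      (ENNReal.ofReal (1 - lam) * a ^ s + ENNReal.ofReal lam * b ^ s) ^ (1 / s) := by
  simp [powMean, hs]

theorem rpow_le_rpow_of_nonpos {z : ℝ} (hz : z ≤ 0) {a b : ℝ≥0∞} (h : a ≤ b) :
    b ^ z ≤ a ^ z := by
  obtain ⟨w, rfl⟩ : ∃ w, z = -w := ⟨-z, by ring⟩
  rw [ENNReal.rpow_neg, ENNReal.rpow_neg]
  exact ENNReal.inv_le_inv.2 (ENNReal.rpow_le_rpow h (by linarith))

theorem powMean_mono (s : EReal) {lam : ℝ} (hlam : lam ∈ Set.Icc (0 : ℝ) 1) {a a' b b' : ℝ≥0∞}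
    (ha : a ≤ a') (hb : b ≤ b') : powMean s lam a b ≤ powMean s lam a' b' := by
  induction s with
  | bot => simpa only [powMean_bot] using min_le_min ha hb
  | top => simpa [powMean] using max_le_max ha hb
  | coe s =>
    rcases eq_or_ne s 0 with rfl | hs
    · simp only [EReal.coe_zero, powMean_zero]
      have h0 := hlam.1
      have h1 := hlam.2
      gcongr
    · rw [powMean_coe hs, powMean_coe hs]
      rcases lt_or_gt_of_ne hs with hs | hs
      · apply rpow_le_rpow_of_nonpos (one_div_nonpos.2 hs.le)
        exact add_le_add (mul_le_mul_right (rpow_le_rpow_of_nonpos hs.le ha) _)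
          (mul_le_mul_right (rpow_le_rpow_of_nonpos hs.le hb) _)
      · gcongr

theorem powMean_mul_left (s : EReal) {lam : ℝ} (hlam : lam ∈ Set.Icc (0 : ℝ) 1) {c : ℝ≥0∞}
    (hc : c ≠ 0) (hc' : c ≠ ∞) (a b : ℝ≥0∞) :
    powMean s lam (c * a) (c * b) = c * powMean s lam a b := by
  induction s with
  | bot => simp only [powMean_bot]; exact (mul_min_of_nonneg a b zero_le).symm
  | top => simp only [powMean, if_true]; simpa using (mul_max_of_nonneg a b zero_le).symm
  | coe s =>
    rcases eq_or_ne s 0 with rfl | hs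
    · simp only [EReal.coe_zero, powMean_zero]
      rw [ENNReal.mul_rpow_of_nonneg _ _ (by linarith [hlam.2]),
        ENNReal.mul_rpow_of_nonneg _ _ hlam.1]
      calc c ^ (1 - lam) * a ^ (1 - lam) * (c ^ lam * b ^ lam)
          = c ^ (1 - lam) * c ^ lam * (a ^ (1 - lam) * b ^ lam) := by ring
        _ = _ := by rw [← ENNReal.rpow_add _ _ hc hc']; simp
    · have key : ∀ x : ℝ≥0∞, ∀ z : ℝ, (c * x) ^ z = c ^ z * x ^ z := by
        intro x z
        rcases le_or_gt 0 z with hz | hz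
        · exact ENNReal.mul_rpow_of_nonneg _ _ hz
        · obtain ⟨w, rfl⟩ : ∃ w, z = -w := ⟨-z, by ring⟩
          simp only [ENNReal.rpow_neg]
          rw [ENNReal.mul_rpow_of_nonneg _ _ (by linarith), ENNReal.mul_inv]
          · left; simp [hc, hc']
          · left; exact ENNReal.rpow_ne_top_of_nonneg (by linarith) hc'
      rw [powMean_coe hs, powMean_coe hs, key, key]
      have : ENNReal.ofReal (1 - lam) * (c ^ s * a ^ s) + ENNReal.ofReal lam * (c ^ s * b ^ s)
          = c ^ s * (ENNReal.ofReal (1 - lam) * a ^ s + ENNReal.ofReal lam * b ^ s) := by ring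
      have hcs : c ^ s ≠ 0 := by simp [hc, hc']
      have hcs' : c ^ s ≠ ∞ := by simp [hc, hc']
      rw [this]
      have key2 : ∀ x : ℝ≥0∞, ∀ z : ℝ, (c ^ s * x) ^ z = (c ^ s) ^ z * x ^ z := by
        intro x z
        rcases le_or_gt 0 z with hz | hz
        · exact ENNReal.mul_rpow_of_nonneg _ _ hz
        · obtain ⟨w, rfl⟩ : ∃ w, z = -w := ⟨-z, by ring⟩
          rw [ENNReal.rpow_neg (c ^ s * x), ENNReal.rpow_neg (c ^ s), ENNReal.rpow_neg x]
          rw [ENNReal.mul_rpow_of_nonneg _ _ (by linarith), ENNReal.mul_inv]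
          · left; exact (ENNReal.rpow_pos (pos_iff_ne_zero.2 hcs) hcs').ne'
          · left; exact ENNReal.rpow_ne_top_of_nonneg (by linarith) hcs'
      rw [key2, ← ENNReal.rpow_mul, mul_one_div_cancel hs, ENNReal.rpow_one]

theorem ofReal_one_sub_add_ofReal {lam : ℝ} (hlam : lam ∈ Set.Icc (0 : ℝ) 1) :
    ENNReal.ofReal (1 - lam) + ENNReal.ofReal lam = 1 := by
  rw [← ENNReal.ofReal_add (by linarith [hlam.2]) hlam.1]; simp

theorem powMean_self (s : EReal) {lam : ℝ} (hlam : lam ∈ Set.Icc (0 : ℝ) 1) (a : ℝ≥0∞) :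
    powMean s lam a a = a := by
  induction s with
  | bot => simp [powMean]
  | top => simp [powMean]
  | coe s =>
    rcases eq_or_ne s 0 with rfl | hs
    · simp only [EReal.coe_zero, powMean_zero]
      rw [← ENNReal.rpow_add_of_nonneg _ _ (by linarith [hlam.2]) hlam.1]; simp
    · rw [powMean_coe hs, ← add_mul, ofReal_one_sub_add_ofReal hlam, one_mul, ← ENNReal.rpow_mul,
        mul_one_div_cancel hs, ENNReal.rpow_one]

/-- The weighted two-term Hölder inequality. -/
theorem rpow_mul_rpow_add_le (u v : ℝ≥0∞) {θ : ℝ} (h0 : 0 ≤ θ) (h1 : θ ≤ 1) (X Y Z W : ℝ≥0∞) :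
    u * (X ^ θ * Y ^ (1 - θ)) + v * (Z ^ θ * W ^ (1 - θ)) ≤
      (u * X + v * Z) ^ θ * (u * Y + v * W) ^ (1 - θ) := by
  have h1' : 0 ≤ 1 - θ := by linarith
  have hw : ∀ w : ℝ≥0∞, w = w ^ θ * w ^ (1 - θ) := fun w => by
    rw [← ENNReal.rpow_add_of_nonneg _ _ h0 h1']; simp
  have := ENNReal.lintegral_mul_norm_pow_le (μ := Measure.count)
    (f := fun b : Bool => cond b (u * X) (v * Z))
    (g := fun b : Bool => cond b (u * Y) (v * W)) (measurable_of_finite _).aemeasurable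
    (measurable_of_finite _).aemeasurable h0 h1' (by ring)
  simp only [lintegral_count, tsum_bool, cond_true, cond_false] at this
  rw [ENNReal.mul_rpow_of_nonneg _ _ h0, ENNReal.mul_rpow_of_nonneg _ _ h0,
    ENNReal.mul_rpow_of_nonneg _ _ h1', ENNReal.mul_rpow_of_nonneg _ _ h1'] at this
  calc u * (X ^ θ * Y ^ (1 - θ)) + v * (Z ^ θ * W ^ (1 - θ))
      = (u ^ θ * u ^ (1 - θ)) * (X ^ θ * Y ^ (1 - θ)) +
        (v ^ θ * v ^ (1 - θ)) * (Z ^ θ * W ^ (1 - θ)) := by rw [← hw, ← hw]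
    _ = v ^ θ * Z ^ θ * (v ^ (1 - θ) * W ^ (1 - θ)) + u ^ θ * X ^ θ * (u ^ (1 - θ) * Y ^ (1 - θ)) := by
        ring
    _ ≤ _ := this
    _ = _ := by rw [add_comm (v * Z), add_comm (v * W)]

/-- The weighted arithmetic-geometric mean inequality. -/
theorem powMean_zero_le_powMean_one {lam : ℝ} (hlam : lam ∈ Set.Icc (0 : ℝ) 1) (a b : ℝ≥0∞) :
    a ^ (1 - lam) * b ^ lam ≤ ENNReal.ofReal (1 - lam) * a + ENNReal.ofReal lam * b := by
  rcases eq_or_lt_of_le hlam.1 with rfl | h0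
  · simp
  rcases eq_or_lt_of_le hlam.2 with rfl | h1
  · simp
  have hu : ENNReal.ofReal (1 - lam) ≠ 0 := by simpa using h1
  have hv : ENNReal.ofReal lam ≠ 0 := by simpa using h0
  rcases eq_or_ne a ∞ with rfl | ha
  · simp [ENNReal.mul_top hu]
  rcases eq_or_ne b ∞ with rfl | hb
  · simp [ENNReal.mul_top hv]
  lift a to ℝ≥0 using ha
  lift b to ℝ≥0 using hb
  have := NNReal.geom_mean_le_arith_mean2_weighted (Real.toNNReal (1 - lam)) (Real.toNNReal lam) a b
    (by rw [← Real.toNNReal_add (by linarith) h0.le]; simp)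
  rw [Real.coe_toNNReal _ (by linarith), Real.coe_toNNReal _ h0.le] at this
  rw [← ENNReal.coe_rpow_of_nonneg _ (by linarith), ← ENNReal.coe_rpow_of_nonneg _ h0.le,
    ENNReal.ofReal, ENNReal.ofReal]
  exact_mod_cast this

theorem powMean_zero_le_powMean {s : ℝ} (hs : 0 ≤ s) {lam : ℝ} (hlam : lam ∈ Set.Icc (0 : ℝ) 1)
    (a b : ℝ≥0∞) : powMean 0 lam a b ≤ powMean (s : EReal) lam a b := by
  rcases eq_or_lt_of_le hs with rfl | hs
  · simp
  rw [powMean_zero, powMean_coe hs.ne', one_div, ENNReal.le_rpow_inv_iff hs,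
    ENNReal.mul_rpow_of_nonneg _ _ hs.le]
  refine le_trans (le_of_eq ?_) (powMean_zero_le_powMean_one hlam _ _)
  simp only [← ENNReal.rpow_mul, mul_comm s]

theorem powMean_le_powMean_one {s : ℝ} (hs : s ∈ Set.Icc (0 : ℝ) 1) {lam : ℝ}
    (hlam : lam ∈ Set.Icc (0 : ℝ) 1) (a b : ℝ≥0∞) :
    powMean (s : EReal) lam a b ≤ ENNReal.ofReal (1 - lam) * a + ENNReal.ofReal lam * b := by
  rcases eq_or_lt_of_le hs.1 with rfl | h0
  · simpa only [EReal.coe_zero, powMean_zero] using powMean_zero_le_powMean_one hlam a b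
  rw [powMean_coe h0.ne', one_div, ENNReal.rpow_inv_le_iff h0]
  simpa [ofReal_one_sub_add_ofReal hlam] using
    rpow_mul_rpow_add_le (ENNReal.ofReal (1 - lam)) (ENNReal.ofReal lam) h0.le hs.2 a 1 b 1

theorem powMean_coe_weight_zero (s : ℝ) (a b : ℝ≥0∞) : powMean (s : EReal) 0 a b = a := by
  rcases eq_or_ne s 0 with rfl | hs
  · simp [powMean_zero]
  · rw [powMean_coe hs]; simp [← ENNReal.rpow_mul, hs]

theorem powMean_coe_weight_one (s : ℝ) (a b : ℝ≥0∞) : powMean (s : EReal) 1 a b = b := by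
  rcases eq_or_ne s 0 with rfl | hs
  · simp [powMean_zero]
  · rw [powMean_coe hs]; simp [← ENNReal.rpow_mul, hs]

theorem powMean_weight_zero_le {s : EReal} (hs : s ≠ ⊤) (a b : ℝ≥0∞) : powMean s 0 a b ≤ a := by
  induction s with
  | bot => simp [powMean_bot]
  | top => exact absurd rfl hs
  | coe s => exact (powMean_coe_weight_zero s a b).le

theorem powMean_weight_one_le {s : EReal} (hs : s ≠ ⊤) (a b : ℝ≥0∞) : powMean s 1 a b ≤ b := by
  induction s with
  | bot => simp [powMean_bot]
  | top => exact absurd rfl hs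
  | coe s => exact (powMean_coe_weight_one s a b).le

/-- The relation `1 / γ = 1 / β + r` between exponents, for `r ≥ 0`, with `γ = 0` if `β = 0`. For
negative `β` it requires `1 / β + r ≤ 0`, and equality there corresponds to `γ = -∞`. -/
def HarmonicShift (β r : ℝ) (γ : EReal) : Prop :=
  (β = 0 ∧ γ = 0) ∨ (0 < β ∧ γ = ((β⁻¹ + r)⁻¹ : ℝ)) ∨
    (β < 0 ∧ β⁻¹ + r < 0 ∧ γ = ((β⁻¹ + r)⁻¹ : ℝ)) ∨ (β < 0 ∧ β⁻¹ + r = 0 ∧ γ = ⊥)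

/-- Hölder's inequality for means: `M_γ(a c ^ r, b d ^ r) ≤ M_β(a, b) M_{1 / r}(c, d)` when
`1 / γ = 1 / β + r`. The power `M_{1 / r}(c ^ r, d ^ r)` is written `(u c + v d) ^ r`, which also
makes sense for `r = 0`. -/
theorem powMean_mul_rpow_le {β r : ℝ} {γ : EReal} (hr : 0 ≤ r) (hγ : HarmonicShift β r γ) {lam : ℝ}
    (hlam : lam ∈ Set.Ioo (0 : ℝ) 1) {a b c d : ℝ≥0∞} (hc : c ≠ 0)
    (hc' : c ≠ ∞) (hd : d ≠ 0) (hd' : d ≠ ∞) :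
    powMean γ lam (a * c ^ r) (b * d ^ r) ≤ powMean (β : EReal) lam a b *
      (ENNReal.ofReal (1 - lam) * c + ENNReal.ofReal lam * d) ^ r := by
  have hlam' := Set.Ioo_subset_Icc_self hlam
  set u := ENNReal.ofReal (1 - lam) with hu
  set v := ENNReal.ofReal lam with hv
  have hu0 : u ≠ 0 := by simpa [hu] using hlam.2
  have hv0 : v ≠ 0 := by simpa [hv] using hlam.1
  have hu1 : u ≠ ∞ := by simp [hu]
  have hv1 : v ≠ ∞ := by simp [hv]
  have hQ0 : u * c + v * d ≠ 0 := by simp [hu0, hc]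
  have hQ1 : u * c + v * d ≠ ∞ := by finiteness
  set Q := u * c + v * d with hQ
  have hneg : ∀ x y : ℝ≥0∞, y ≠ 0 → y ≠ ∞ → ∀ z w : ℝ, (x * y ^ z) ^ w = x ^ w * y ^ (z * w) := by
    intro x y hy hy' z w
    have h0 : y ^ z ≠ 0 := by simp [hy, hy']
    have h1 : y ^ z ≠ ∞ := by simp [hy, hy']
    rw [ENNReal.rpow_mul]
    rcases le_or_gt 0 w with hw | hw
    · exact ENNReal.mul_rpow_of_nonneg _ _ hw
    · obtain ⟨t, rfl⟩ : ∃ t, w = -t := ⟨-w, by ring⟩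
      have ht : 0 ≤ t := by linarith
      rw [ENNReal.rpow_neg, ENNReal.rpow_neg, ENNReal.rpow_neg, ENNReal.mul_rpow_of_nonneg _ _ ht,
        ENNReal.mul_inv]
      · right; exact ENNReal.rpow_ne_top_of_nonneg ht h1
      · right; exact (ENNReal.rpow_pos (pos_iff_ne_zero.2 h0) h1).ne'
  rcases hγ with ⟨rfl, rfl⟩ | ⟨hβ, rfl⟩ | ⟨hβ, hβr, rfl⟩ | ⟨hβ, hβr, rfl⟩
  -- `β = 0`: the claim is the arithmetic-geometric mean inequality for `c` and `d`.
  · simp only [EReal.coe_zero, powMean_zero]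
    rw [hneg _ _ hc hc', hneg _ _ hd hd']
    calc a ^ (1 - lam) * c ^ (r * (1 - lam)) * (b ^ lam * d ^ (r * lam))
        = a ^ (1 - lam) * b ^ lam * (c ^ (1 - lam) * d ^ lam) ^ r := by
          rw [ENNReal.mul_rpow_of_nonneg _ _ hr, ← ENNReal.rpow_mul, ← ENNReal.rpow_mul,
            mul_comm r, mul_comm r]
          ring
      _ ≤ _ := by
          gcongr
          exact powMean_zero_le_powMean_one hlam' c d
  -- `β > 0`: Hölder's inequality with exponents `γ / β` and `r γ`, which add up to `1`.
  · have hpos : 0 < β⁻¹ + r := by positivity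
    set g := (β⁻¹ + r)⁻¹ with hg
    have hg0 : 0 < g := inv_pos.2 hpos
    have e1 : g / β + r * g = 1 := by rw [hg]; field_simp
    have e2 : r * g = 1 - g / β := by linarith
    have hr0 : 0 ≤ r * g := by positivity
    rw [powMean_coe hg0.ne', powMean_coe hβ.ne', hneg _ _ hc hc', hneg _ _ hd hd', one_div,
      ENNReal.rpow_inv_le_iff hg0, ENNReal.mul_rpow_of_nonneg _ _ hg0.le, ← ENNReal.rpow_mul,
      ← ENNReal.rpow_mul, e2]
    have := rpow_mul_rpow_add_le u v (θ := g / β) (by positivity) (by linarith)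
      (a ^ β) c (b ^ β) d
    rw [← ENNReal.rpow_mul, ← ENNReal.rpow_mul, mul_div_cancel₀ _ hβ.ne'] at this
    rw [show 1 / β * g = g / β by ring]
    exact this
  -- `β < 0` and `γ > -∞`: as `a ^ β = ((a c ^ r) ^ γ) ^ θ * c ^ (1 - θ)` for `θ = β / γ ∈ (0, 1]`,
  -- Hölder's inequality bounds `M_β(a, b) ^ β`; the negative power `1 / β` reverses it.
  · set g := (β⁻¹ + r)⁻¹ with hg
    have hg0 : g < 0 := inv_lt_zero.2 hβr
    have hβ' : β ≠ 0 := hβ.ne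
    have e1 : β / g = 1 + r * β := by
      rw [hg, div_inv_eq_mul]; field_simp
    have e2 : 0 < β / g := div_pos_of_neg_of_neg hβ hg0
    have e3 : r * β ≤ 0 := mul_nonpos_of_nonneg_of_nonpos hr hβ.le
    have key := rpow_mul_rpow_add_le u v (θ := β / g) e2.le (by linarith)
      ((a * c ^ r) ^ g) c ((b * d ^ r) ^ g) d
    rw [← ENNReal.rpow_mul, ← ENNReal.rpow_mul, mul_div_cancel₀ _ hg0.ne, hneg _ _ hc hc',
      hneg _ _ hd hd', mul_assoc, mul_assoc, ← ENNReal.rpow_add _ _ hc hc',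
      ← ENNReal.rpow_add _ _ hd hd', show r * β + (1 - β / g) = 0 by linarith] at key
    simp only [ENNReal.rpow_zero, mul_one] at key
    have := rpow_le_rpow_of_nonpos (one_div_nonpos.2 hβ.le) key
    rw [hneg _ _ hQ0 hQ1, ← ENNReal.rpow_mul, show β / g * (1 / β) = 1 / g by field_simp,
      show (1 - β / g) * (1 / β) = -r by rw [e1]; field_simp; ring_nf] at this
    rw [powMean_coe hg0.ne, powMean_coe hβ']
    refine le_trans ?_ (mul_le_mul_left this (Q ^ r))
    rw [mul_assoc, ← ENNReal.rpow_add _ _ hQ0 hQ1]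
    simp [hu, hv]
  -- `γ = -∞`: the limit case `θ = 0` of the previous one.
  · have hβ' : β ≠ 0 := hβ.ne
    have e1 : r * β = -1 := by
      have : r = -β⁻¹ := by linarith
      rw [this]; field_simp
    rw [powMean_bot, powMean_coe hβ']
    set m := min (a * c ^ r) (b * d ^ r) with hm
    have h1 : a ^ β ≤ m ^ β * c := by
      have := rpow_le_rpow_of_nonpos hβ.le (min_le_left (a * c ^ r) (b * d ^ r))
      rw [hneg _ _ hc hc', e1, ← hm] at this
      calc a ^ β = a ^ β * c ^ (-1 : ℝ) * c := by
            rw [mul_assoc, ENNReal.rpow_neg_one, ENNReal.inv_mul_cancel hc hc', mul_one]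
        _ ≤ _ := by gcongr
    have h2 : b ^ β ≤ m ^ β * d := by
      have := rpow_le_rpow_of_nonpos hβ.le (min_le_right (a * c ^ r) (b * d ^ r))
      rw [hneg _ _ hd hd', e1, ← hm] at this
      calc b ^ β = b ^ β * d ^ (-1 : ℝ) * d := by
            rw [mul_assoc, ENNReal.rpow_neg_one, ENNReal.inv_mul_cancel hd hd', mul_one]
        _ ≤ _ := by gcongr
    have h3 : u * a ^ β + v * b ^ β ≤ m ^ β * Q ^ (1 : ℝ) := by
      rw [ENNReal.rpow_one]
      calc _ ≤ u * (m ^ β * c) + v * (m ^ β * d) := by gcongr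
        _ = _ := by rw [hQ]; ring
    have := rpow_le_rpow_of_nonpos (one_div_nonpos.2 hβ.le) h3
    rw [hneg _ _ hQ0 hQ1, ← ENNReal.rpow_mul, mul_one_div_cancel hβ', ENNReal.rpow_one,
      show 1 * (1 / β) = -r by field_simp; linarith] at this
    refine le_trans ?_ (mul_le_mul_left this (Q ^ r))
    rw [mul_assoc, ← ENNReal.rpow_add _ _ hQ0 hQ1]
    simp

/-- The restriction to nonzero limits excludes the discontinuity of the geometric mean at
`(0, ∞)`. -/
theorem tendsto_powMean {s : EReal} (hs : s ≠ ⊤) {lam : ℝ} (hlam : lam ∈ Set.Icc (0 : ℝ) 1)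
    {a b : ℝ≥0∞} (ha : a ≠ 0) (hb : b ≠ 0)
    {x y : ℕ → ℝ≥0∞} (hx : Tendsto x atTop (𝓝 a)) (hy : Tendsto y atTop (𝓝 b)) :
    Tendsto (fun k => powMean s lam (x k) (y k)) atTop (𝓝 (powMean s lam a b)) := by
  induction s with
  | bot => simpa only [powMean_bot] using hx.min hy
  | top => exact absurd rfl hs
  | coe s =>
    rcases eq_or_ne s 0 with rfl | hs
    · simp only [EReal.coe_zero, powMean_zero]
      have h1 : 0 ≤ 1 - lam := by linarith [hlam.2]
      refine ENNReal.Tendsto.mul (hx.ennrpow_const _) (Or.inl ?_) (hy.ennrpow_const _) (Or.inl ?_)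
      · simp [ha, hlam.2]
      · simp [hb, hlam.1]
    · simp only [powMean_coe hs]
      refine Tendsto.ennrpow_const _ (Tendsto.add ?_ ?_)
      · exact ENNReal.Tendsto.const_mul (hx.ennrpow_const _) (Or.inr (by simp))
      · exact ENNReal.Tendsto.const_mul (hy.ennrpow_const _) (Or.inr (by simp))

/-! ### The Borell-Brascamp-Lieb inequality on the line -/

theorem volume_affine_image (K : Set ℝ) {a : ℝ} (ha : 0 ≤ a) (c : ℝ) :
    volume ((fun x => a * x + c) '' K) = ENNReal.ofReal a * volume K := by
  have : (fun x => a * x + c) '' K = (fun x => x + c) '' (a • K) := by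
    rw [← image_smul, image_image]; rfl
  rw [this, image_add_right, measure_preimage_add_right, Measure.addHaar_smul]
  simp [abs_of_nonneg ha]

/-- The sum of two compact sets contains two translates, of one and of the other, which meet in a
single point. -/
theorem volume_add_volume_le_of_isCompact {K L C : Set ℝ} (hK : IsCompact K) (hL : IsCompact L)
    (hK0 : K.Nonempty) (hL0 : L.Nonempty) {lam : ℝ} (hlam : lam ∈ Icc (0 : ℝ) 1)
    (hC : ∀ s ∈ K, ∀ t ∈ L, (1 - lam) * s + lam * t ∈ C) :
    ENNReal.ofReal (1 - lam) * volume K + ENNReal.ofReal lam * volume L ≤ volume C := by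
  obtain ⟨s, hs, hs'⟩ := hK.exists_isGreatest hK0
  obtain ⟨t, ht, ht'⟩ := hL.exists_isLeast hL0
  have h1 : 0 ≤ 1 - lam := by linarith [hlam.2]
  rw [← volume_affine_image K h1 (lam * t), ← volume_affine_image L hlam.1 ((1 - lam) * s),
    ← measure_union₀]
  · apply measure_mono
    rintro _ (⟨x, hx, rfl⟩ | ⟨x, hx, rfl⟩)
    · exact hC x hx t ht
    · simpa only [add_comm] using hC s hs x hx
  · exact (hL.image (by fun_prop)).measurableSet.nullMeasurableSet
  · refine measure_mono_null ?_ (measure_singleton ((1 - lam) * s + lam * t))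
    rintro _ ⟨⟨x, hx, rfl⟩, ⟨y, hy, hxy⟩⟩
    have h2 := mul_le_mul_of_nonneg_left (hs' hx) h1
    have h3 := mul_le_mul_of_nonneg_left (ht' hy) hlam.1
    simp only [mem_singleton_iff] at hxy ⊢
    linarith

/-- The Brunn-Minkowski inequality on the line. -/
theorem volume_add_volume_le {A B C : Set ℝ} (hA : MeasurableSet A) (hB : MeasurableSet B)
    (hA0 : A.Nonempty) (hB0 : B.Nonempty) {lam : ℝ} (hlam : lam ∈ Icc (0 : ℝ) 1)
    (hC : ∀ s ∈ A, ∀ t ∈ B, (1 - lam) * s + lam * t ∈ C) :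
    ENNReal.ofReal (1 - lam) * volume A + ENNReal.ofReal lam * volume B ≤ volume C := by
  obtain ⟨a, ha⟩ := hA0
  obtain ⟨b, hb⟩ := hB0
  have key : ∀ S : Set ℝ, MeasurableSet S →
      volume S = ⨆ K : {K : Set ℝ // IsCompact K ∧ K ⊆ S}, volume (K : Set ℝ) := by
    intro S hS
    rw [hS.measure_eq_iSup_isCompact]
    simp only [iSup_subtype, iSup_and]
    exact iSup_congr fun K => iSup_comm
  have hne : ∀ S : Set ℝ, Nonempty {K : Set ℝ // IsCompact K ∧ K ⊆ S} := fun S =>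
    ⟨∅, isCompact_empty, empty_subset _⟩
  have := hne A
  have := hne B
  rw [key A hA, key B hB, ENNReal.mul_iSup, ENNReal.mul_iSup, ENNReal.iSup_add]
  refine iSup_le fun K => ?_
  rw [ENNReal.add_iSup]
  refine iSup_le fun L => ?_
  have hK' : insert a K.1 ⊆ A := insert_subset ha K.2.2
  have hL' : insert b L.1 ⊆ B := insert_subset hb L.2.2
  refine le_trans ?_ (volume_add_volume_le_of_isCompact (K.2.1.insert a) (L.2.1.insert b)
    (insert_nonempty _ _) (insert_nonempty _ _) hlam
    fun s hs t ht => hC s (hK' hs) t (hL' ht))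
  gcongr <;> exact subset_insert _ _

/-- The layer cake formula for a function with values in `[0, 1]`. -/
theorem lintegral_eq_lintegral_Ioo_meas_lt {f : ℝ → ℝ≥0∞} (hf : Measurable f) (h1 : ∀ x, f x ≤ 1) :
    ∫⁻ x, f x = ∫⁻ t in Ioo (0 : ℝ) 1, volume {x | ENNReal.ofReal t < f x} := by
  have hfin : ∀ x, f x ≠ ∞ := fun x => ne_top_of_le_ne_top ENNReal.one_ne_top (h1 x)
  have := lintegral_eq_lintegral_meas_lt volume (f := fun x => (f x).toReal)
    (Eventually.of_forall fun x => ENNReal.toReal_nonneg) hf.ennreal_toReal.aemeasurable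
  simp only [ENNReal.ofReal_toReal (hfin _)] at this
  have hzero : ∫⁻ t in Ici (1 : ℝ), volume {x | t < (f x).toReal} = 0 := by
    refine setLIntegral_eq_zero measurableSet_Ici fun t (ht : 1 ≤ t) => ?_
    convert! measure_empty (μ := volume)
    ext x
    simp only [mem_ofPred_eq, mem_empty_iff_false, iff_false, not_lt]
    exact le_trans (ENNReal.toReal_mono ENNReal.one_ne_top (h1 x)) (by simpa using ht)
  rw [this, ← Ioo_union_Ici_eq_Ioi (zero_lt_one' ℝ), lintegral_union measurableSet_Ici, hzero,
    add_zero]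
  · refine setLIntegral_congr_fun measurableSet_Ioo fun t ht => ?_
    simp only [ENNReal.ofReal_lt_iff_lt_toReal ht.1.le (hfin _)]
  · exact Set.disjoint_left.2 fun t ht ht' => not_le.2 ht.2 ht'

/-- Comparing superlevel sets by the one-dimensional Brunn-Minkowski inequality. -/
theorem lintegral_add_lintegral_le_of_min_le {f g h : ℝ → ℝ≥0∞} (hf : Measurable f)
    (hg : Measurable g) (hh : Measurable h) (hf1 : ⨆ x, f x = 1) (hg1 : ⨆ x, g x = 1)
    {lam : ℝ} (hlam : lam ∈ Icc (0 : ℝ) 1)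
    (hle : ∀ s t, min (f s) (g t) ≤ h ((1 - lam) * s + lam * t)) :
    ENNReal.ofReal (1 - lam) * (∫⁻ x, f x) + ENNReal.ofReal lam * (∫⁻ x, g x) ≤ ∫⁻ x, h x := by
  have hmeas : ∀ k : ℝ → ℝ≥0∞, Measurable fun t : ℝ => volume {x | ENNReal.ofReal t < k x} := by
    intro k
    apply Antitone.measurable
    intro t t' htt'
    exact measure_mono fun x (hx : _ < _) => lt_of_le_of_lt (ENNReal.ofReal_le_ofReal htt') hx
  calc _ = ∫⁻ t in Ioo (0 : ℝ) 1, (ENNReal.ofReal (1 - lam) * volume {x | ENNReal.ofReal t < f x} +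
          ENNReal.ofReal lam * volume {x | ENNReal.ofReal t < g x}) := by
        rw [lintegral_eq_lintegral_Ioo_meas_lt hf fun x => hf1 ▸ le_iSup f x,
          lintegral_eq_lintegral_Ioo_meas_lt hg fun x => hg1 ▸ le_iSup g x,
          lintegral_add_left ((hmeas f).const_mul _), lintegral_const_mul _ (hmeas f),
          lintegral_const_mul _ (hmeas g)]
    _ ≤ ∫⁻ t in Ioo (0 : ℝ) 1, volume {x | ENNReal.ofReal t < min (h x) 1} := by
        refine setLIntegral_mono (hmeas _) fun t ht => ?_
        have ht1 : ENNReal.ofReal t < 1 := by simpa using ht.2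
        obtain ⟨a, ha⟩ := lt_iSup_iff.1 (hf1.symm ▸ ht1)
        obtain ⟨b, hb⟩ := lt_iSup_iff.1 (hg1.symm ▸ ht1)
        refine volume_add_volume_le (measurableSet_lt measurable_const hf)
          (measurableSet_lt measurable_const hg) ⟨a, ha⟩ ⟨b, hb⟩ hlam fun s hs t' ht' => ?_
        exact lt_min (lt_of_lt_of_le (lt_min hs ht') (hle s t')) ht1
    _ = ∫⁻ x, min (h x) 1 :=
        (lintegral_eq_lintegral_Ioo_meas_lt (hh.min measurable_const) fun x => min_le_right _ _).symm
    _ ≤ _ := lintegral_mono fun x => min_le_left _ _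

theorem HarmonicShift.ne_top {β r : ℝ} {γ : EReal} (h : HarmonicShift β r γ) : γ ≠ ⊤ := by
  rcases h with ⟨_, rfl⟩ | ⟨_, rfl⟩ | ⟨_, _, rfl⟩ | ⟨_, _, rfl⟩ <;> simp

theorem powMean_ne_zero (s : EReal) {lam : ℝ} (hlam : lam ∈ Icc (0 : ℝ) 1) {a b : ℝ≥0∞}
    (ha : a ≠ 0) (hb : b ≠ 0) : powMean s lam a b ≠ 0 := by
  have h : min a b ≤ powMean s lam a b := by
    conv_lhs => rw [← powMean_self s hlam (min a b)]
    exact powMean_mono s hlam (min_le_left _ _) (min_le_right _ _)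
  have : 0 < min a b := lt_min (pos_iff_ne_zero.2 ha) (pos_iff_ne_zero.2 hb)
  exact (this.trans_le h).ne'

theorem powMean_ne_top (s : EReal) {lam : ℝ} (hlam : lam ∈ Icc (0 : ℝ) 1) {a b : ℝ≥0∞}
    (ha : a ≠ ∞) (hb : b ≠ ∞) : powMean s lam a b ≠ ∞ := by
  have h : powMean s lam a b ≤ max a b := by
    conv_rhs => rw [← powMean_self s hlam (max a b)]
    exact powMean_mono s hlam (le_max_left _ _) (le_max_right _ _)
  exact ne_top_of_le_ne_top (max_lt ha.lt_top hb.lt_top).ne h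

/-- The Borell-Brascamp-Lieb inequality for bounded functions. After division of `f` and `g` by
their suprema `a` and `b`, and of `h` by `m = M_δ(a, b)`, superlevel sets at equal heights can be
compared; Hölder's inequality for means then recombines `M_δ(a, b)` with the mean of the
normalized integrals. -/
theorem powMean_lintegral_le_of_bounded {δ : ℝ} {γ : EReal} (hγ : HarmonicShift δ 1 γ)
    {f g h : ℝ → ℝ≥0∞} (hf : Measurable f) (hg : Measurable g) (hh : Measurable h)
    (hfb : ⨆ x, f x ≠ ∞) (hgb : ⨆ x, g x ≠ ∞) (hf0 : ∫⁻ x, f x ≠ 0) (hg0 : ∫⁻ x, g x ≠ 0)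
    (hf1 : ∫⁻ x, f x ≠ ∞) (hg1 : ∫⁻ x, g x ≠ ∞) {lam : ℝ} (hlam : lam ∈ Ioo (0 : ℝ) 1)
    (hle : ∀ s t, f s ≠ 0 → g t ≠ 0 →
      powMean (δ : EReal) lam (f s) (g t) ≤ h ((1 - lam) * s + lam * t)) :
    powMean γ lam (∫⁻ x, f x) (∫⁻ x, g x) ≤ ∫⁻ x, h x := by
  have hlam' := Ioo_subset_Icc_self hlam
  set a := ⨆ x, f x with ha
  set b := ⨆ x, g x with hb
  have ha0 : a ≠ 0 := by
    contrapose! hf0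
    have : ∀ x, f x = 0 := fun x => le_antisymm (hf0 ▸ le_iSup f x) zero_le
    simp [this]
  have hb0 : b ≠ 0 := by
    contrapose! hg0
    have : ∀ x, g x = 0 := fun x => le_antisymm (hg0 ▸ le_iSup g x) zero_le
    simp [this]
  set m := powMean (δ : EReal) lam a b with hm
  have hm0 : m ≠ 0 := powMean_ne_zero _ hlam' ha0 hb0
  have hm1 : m ≠ ∞ := powMean_ne_top _ hlam' hfb hgb
  have key := lintegral_add_lintegral_le_of_min_le (f := fun x => a⁻¹ * f x)
    (g := fun x => b⁻¹ * g x) (h := fun x => m⁻¹ * h x) (hf.const_mul _) (hg.const_mul _)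
    (hh.const_mul _) (by rw [← ENNReal.mul_iSup, ← ha, ENNReal.inv_mul_cancel ha0 hfb])
    (by rw [← ENNReal.mul_iSup, ← hb, ENNReal.inv_mul_cancel hb0 hgb]) hlam' ?_
  · rw [lintegral_const_mul _ hf, lintegral_const_mul _ hg, lintegral_const_mul _ hh] at key
    have hol := powMean_mul_rpow_le zero_le_one hγ hlam (a := a) (b := b)
      (c := a⁻¹ * ∫⁻ x, f x) (d := b⁻¹ * ∫⁻ x, g x) (mul_ne_zero (ENNReal.inv_ne_zero.2 hfb) hf0)
      (ENNReal.mul_ne_top (ENNReal.inv_ne_top.2 ha0) hf1)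
      (mul_ne_zero (ENNReal.inv_ne_zero.2 hgb) hg0)
      (ENNReal.mul_ne_top (ENNReal.inv_ne_top.2 hb0) hg1)
    simp only [ENNReal.rpow_one] at hol
    rw [ENNReal.mul_inv_cancel_left ha0 hfb, ENNReal.mul_inv_cancel_left hb0 hgb] at hol
    refine hol.trans ((mul_le_mul_right key m).trans ?_)
    rw [ENNReal.mul_inv_cancel_left hm0 hm1]
  · intro s t
    by_cases hs : f s = 0
    · simp [hs]
    by_cases ht : g t = 0
    · simp [ht]
    set τ := min (a⁻¹ * f s) (b⁻¹ * g t) with hτ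
    have hτ0 : τ ≠ 0 := (lt_min (by simp [pos_iff_ne_zero, hs, hfb])
      (by simp [pos_iff_ne_zero, ht, hgb])).ne'
    have hτ1 : τ ≠ ∞ := by
      have : a⁻¹ * f s ≠ ∞ :=
        ENNReal.mul_ne_top (by simp [ha0]) (ne_top_of_le_ne_top hfb (le_iSup f s))
      exact ne_top_of_le_ne_top this (min_le_left _ _)
    have h1 : τ * a ≤ f s := by
      calc τ * a ≤ a⁻¹ * f s * a := by gcongr; exact min_le_left _ _
        _ = f s := by rw [mul_comm, ENNReal.mul_inv_cancel_left ha0 hfb]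
    have h2 : τ * b ≤ g t := by
      calc τ * b ≤ b⁻¹ * g t * b := by gcongr; exact min_le_right _ _
        _ = g t := by rw [mul_comm, ENNReal.mul_inv_cancel_left hb0 hgb]
    have h3 : τ * m ≤ h ((1 - lam) * s + lam * t) := by
      rw [hm, ← powMean_mul_left _ hlam' hτ0 hτ1]
      exact (powMean_mono _ hlam' h1 h2).trans (hle s t hs ht)
    calc τ = m⁻¹ * (τ * m) := by
          rw [mul_comm τ, ← mul_assoc, ENNReal.inv_mul_cancel hm0 hm1, one_mul]
      _ ≤ _ := by gcongr

/-- The Borell-Brascamp-Lieb inequality on the line. -/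
theorem powMean_lintegral_le {δ : ℝ} {γ : EReal} (hγ : HarmonicShift δ 1 γ)
    {f g h : ℝ → ℝ≥0∞} (hf : Measurable f) (hg : Measurable g) (hh : Measurable h)
    (hf0 : ∫⁻ x, f x ≠ 0) (hg0 : ∫⁻ x, g x ≠ 0) {lam : ℝ} (hlam : lam ∈ Ioo (0 : ℝ) 1)
    (hle : ∀ s t, f s ≠ 0 → g t ≠ 0 →
      powMean (δ : EReal) lam (f s) (g t) ≤ h ((1 - lam) * s + lam * t)) :
    powMean γ lam (∫⁻ x, f x) (∫⁻ x, g x) ≤ ∫⁻ x, h x := by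
  have hlam' := Ioo_subset_Icc_self hlam
  -- Truncation in height and in width reduces to bounded functions with finite integrals.
  let T : (ℝ → ℝ≥0∞) → ℕ → ℝ → ℝ≥0∞ := fun k N =>
    (Icc (-N : ℝ) N).indicator fun x => min (k x) N
  have hTm : ∀ k, Measurable k → ∀ N, Measurable (T k N) := fun k hk N =>
    (hk.min measurable_const).indicator measurableSet_Icc
  have hTle : ∀ k N x, T k N x ≤ k x := fun k N x =>
    (indicator_le_self _ _ _).trans (min_le_left _ _)
  have hTN : ∀ k N x, T k N x ≤ N := fun k N x =>
    (indicator_le_self _ _ _).trans (min_le_right _ _)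
  have hTb : ∀ k N, ⨆ x, T k N x ≠ ∞ := fun k N =>
    ne_top_of_le_ne_top (ENNReal.natCast_ne_top N) (iSup_le (hTN k N))
  have hTi : ∀ k N, ∫⁻ x, T k N x ≠ ∞ := by
    intro k N
    have : ∫⁻ x, T k N x ≤ ∫⁻ x in Icc (-N : ℝ) N, (N : ℝ≥0∞) := by
      rw [lintegral_indicator measurableSet_Icc]
      exact lintegral_mono fun x => min_le_right _ _
    refine ne_top_of_le_ne_top ?_ this
    rw [setLIntegral_const, Real.volume_Icc]
    finiteness
  have hTt : ∀ k, Measurable k →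
      Tendsto (fun N => ∫⁻ x, T k N x) atTop (𝓝 (∫⁻ x, k x)) := by
    intro k hk
    refine lintegral_tendsto_of_tendsto_of_monotone (fun N => (hTm k hk N).aemeasurable)
      (Eventually.of_forall fun x N M hNM => ?_) (Eventually.of_forall fun x => ?_)
    · have h1 : (N : ℝ) ≤ M := by exact_mod_cast hNM
      refine (indicator_le_indicator_of_subset (Icc_subset_Icc (neg_le_neg h1) h1)
        (fun _ => zero_le) x).trans (indicator_le_indicator ?_)
      exact min_le_min le_rfl (by exact_mod_cast hNM)
    · obtain ⟨M, hM⟩ := exists_nat_ge |x|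
      have h1 : Tendsto (fun N : ℕ => min (k x) (N : ℝ≥0∞)) atTop (𝓝 (min (k x) ∞)) :=
        tendsto_const_nhds.min ENNReal.tendsto_nat_nhds_top
      rw [min_eq_left le_top] at h1
      refine h1.congr' ?_
      filter_upwards [eventually_ge_atTop M] with N hN
      have h2 : (M : ℝ) ≤ N := by exact_mod_cast hN
      exact (indicator_of_mem (show x ∈ Icc (-N : ℝ) N from abs_le.1 (hM.trans h2))
        (fun x => min (k x) (N : ℝ≥0∞))).symm
  refine le_of_tendsto (tendsto_powMean hγ.ne_top hlam' hf0 hg0 (hTt f hf) (hTt g hg)) ?_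
  filter_upwards [(hTt f hf).eventually_ne hf0, (hTt g hg).eventually_ne hg0] with N h1 h2
  refine powMean_lintegral_le_of_bounded hγ (hTm f hf N) (hTm g hg N) hh (hTb f N) (hTb g N) h1 h2
    (hTi f N) (hTi g N) hlam fun s t hs ht => ?_
  refine (powMean_mono _ hlam' (hTle f N s) (hTle g N t)).trans (hle s t ?_ ?_)
  · intro h0; exact hs (le_antisymm (h0 ▸ hTle f N s) zero_le)
  · intro h0; exact ht (le_antisymm (h0 ▸ hTle g N t) zero_le)

/-! ### Power means of the variable on the half-line -/

/-- The coordinate mean of two positive real numbers occurring in `pMeanPoint`. -/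
noncomputable def realMean (p lam s t : ℝ) : ℝ :=
  (powMean (p : EReal) lam (ENNReal.ofReal s) (ENNReal.ofReal t)).toReal

theorem realMean_pos (p : ℝ) {lam : ℝ} (hlam : lam ∈ Ioo (0 : ℝ) 1) {s t : ℝ} (hs : 0 < s)
    (ht : 0 < t) : 0 < realMean p lam s t :=
  ENNReal.toReal_pos
    (powMean_ne_zero _ (Ioo_subset_Icc_self hlam) (by simpa using hs) (by simpa using ht))
    (powMean_ne_top _ (Ioo_subset_Icc_self hlam) (by simp) (by simp))

theorem realMean_zero {lam : ℝ} (hlam : lam ∈ Icc (0 : ℝ) 1) (s t : ℝ) :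
    realMean 0 lam (Real.exp s) (Real.exp t) = Real.exp ((1 - lam) * s + lam * t) := by
  rw [realMean, EReal.coe_zero, powMean_zero, ENNReal.toReal_mul, ENNReal.ofReal_rpow_of_nonneg
    (Real.exp_pos _).le (by linarith [hlam.2]), ENNReal.ofReal_rpow_of_nonneg
    (Real.exp_pos _).le hlam.1, ENNReal.toReal_ofReal (by positivity),
    ENNReal.toReal_ofReal (by positivity), ← Real.exp_mul, ← Real.exp_mul, ← Real.exp_add]
  ring_nf

theorem realMean_of_pos {p : ℝ} (hp : 0 < p) {lam : ℝ} (hlam : lam ∈ Icc (0 : ℝ) 1) {s t : ℝ}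
    (hs : 0 < s) (ht : 0 < t) :
    realMean p lam (s ^ p⁻¹) (t ^ p⁻¹) = ((1 - lam) * s + lam * t) ^ p⁻¹ := by
  have h1 : 0 ≤ 1 - lam := by linarith [hlam.2]
  have h2 : 0 ≤ (1 - lam) * s := mul_nonneg h1 hs.le
  have h3 : 0 ≤ lam * t := mul_nonneg hlam.1 ht.le
  rw [realMean, powMean_coe hp.ne', ENNReal.ofReal_rpow_of_nonneg (by positivity) hp.le,
    ENNReal.ofReal_rpow_of_nonneg (by positivity) hp.le, Real.rpow_inv_rpow hs.le hp.ne',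
    Real.rpow_inv_rpow ht.le hp.ne', ← ENNReal.ofReal_mul h1, ← ENNReal.ofReal_mul hlam.1,
    ← ENNReal.ofReal_add h2 h3, ENNReal.ofReal_rpow_of_nonneg (add_nonneg h2 h3) (by positivity),
    ENNReal.toReal_ofReal (Real.rpow_nonneg (add_nonneg h2 h3) _), one_div]

/-- Shifts can be performed in two steps. Since the second one is by `q > 0`, the intermediate
exponent is never `-∞`. -/
theorem HarmonicShift.exists_add {α r q : ℝ} {γ : EReal} (hr : 0 ≤ r) (hq : 0 < q)
    (h : HarmonicShift α (r + q) γ) :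
    ∃ β : ℝ, HarmonicShift α r β ∧ HarmonicShift β q γ := by
  rcases h with ⟨hα, hγ⟩ | ⟨hα, hγ⟩ | ⟨hα, hαr, hγ⟩ | ⟨hα, hαr, hγ⟩
  · exact ⟨0, Or.inl ⟨hα, rfl⟩, Or.inl ⟨rfl, hγ⟩⟩
  · have : 0 < α⁻¹ := inv_pos.2 hα
    refine ⟨(α⁻¹ + r)⁻¹, Or.inr (Or.inl ⟨hα, rfl⟩),
      Or.inr (Or.inl ⟨inv_pos.2 (by linarith), ?_⟩)⟩
    rw [hγ, inv_inv, add_assoc]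
  · refine ⟨(α⁻¹ + r)⁻¹, Or.inr (Or.inr (Or.inl ⟨hα, by linarith, rfl⟩)),
      Or.inr (Or.inr (Or.inl ⟨inv_lt_zero.2 (by linarith), ?_, ?_⟩))⟩
    · rw [inv_inv]; linarith
    · rw [hγ, inv_inv, add_assoc]
  · refine ⟨(α⁻¹ + r)⁻¹, Or.inr (Or.inr (Or.inl ⟨hα, by linarith, rfl⟩)),
      Or.inr (Or.inr (Or.inr ⟨inv_lt_zero.2 (by linarith), ?_, hγ⟩))⟩
    rw [inv_inv]; linarith

/-- The Borell-Brascamp-Lieb inequality transported to the half-line by a change of variables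
`φ`. -/
theorem powMean_lintegral_le_of_substitution {δ : ℝ} {γ : EReal} (hγ : HarmonicShift δ 1 γ)
    {S : Set ℝ} (hS : MeasurableSet S) {φ φ' : ℝ → ℝ} (hφ : Measurable φ) (hφ' : Measurable φ')
    (hd : ∀ x ∈ S, HasDerivWithinAt φ (φ' x) S x) (hinj : InjOn φ S) (him : φ '' S = Ioi 0)
    (hpos : ∀ x ∈ S, 0 ≤ φ' x) {lam : ℝ} (hlam : lam ∈ Ioo (0 : ℝ) 1)
    (hconv : ∀ s ∈ S, ∀ t ∈ S, (1 - lam) * s + lam * t ∈ S)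
    {F G H : ℝ → ℝ≥0∞} (hF : Measurable F) (hG : Measurable G) (hH : Measurable H)
    (hF0 : ∫⁻ x in Ioi 0, F x ≠ 0) (hG0 : ∫⁻ x in Ioi 0, G x ≠ 0)
    (hle : ∀ s ∈ S, ∀ t ∈ S, F (φ s) ≠ 0 → G (φ t) ≠ 0 →
      powMean (δ : EReal) lam (F (φ s) * ENNReal.ofReal (φ' s)) (G (φ t) * ENNReal.ofReal (φ' t)) ≤
        H (φ ((1 - lam) * s + lam * t)) * ENNReal.ofReal (φ' ((1 - lam) * s + lam * t))) :
    powMean γ lam (∫⁻ x in Ioi 0, F x) (∫⁻ x in Ioi 0, G x) ≤ ∫⁻ x in Ioi 0, H x := by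
  let T : (ℝ → ℝ≥0∞) → ℝ → ℝ≥0∞ := fun k => S.indicator fun s => k (φ s) * ENNReal.ofReal (φ' s)
  have hTm : ∀ k, Measurable k → Measurable (T k) := fun k hk =>
    ((hk.comp hφ).mul hφ'.ennreal_ofReal).indicator hS
  have hTi : ∀ k, ∫⁻ x in Ioi 0, k x = ∫⁻ x, T k x := by
    intro k
    rw [lintegral_indicator hS, ← him, lintegral_image_eq_lintegral_abs_deriv_mul hS hd hinj]
    refine setLIntegral_congr_fun hS fun x hx => ?_
    simp only [abs_of_nonneg (hpos x hx), mul_comm]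
  simp only [hTi] at hF0 hG0 ⊢
  refine powMean_lintegral_le hγ (hTm F hF) (hTm G hG) (hTm H hH) hF0 hG0 hlam fun s t hs ht => ?_
  have hsS : s ∈ S := by
    by_contra h
    exact hs (indicator_of_notMem h _)
  have htS : t ∈ S := by
    by_contra h
    exact ht (indicator_of_notMem h _)
  simp only [T, indicator_of_mem hsS, indicator_of_mem htS,
    indicator_of_mem (hconv s hsS t htS)] at hs ht ⊢
  exact hle s hsS t htS (left_ne_zero_of_mul hs) (left_ne_zero_of_mul ht)

/-- The Borell-Brascamp-Lieb inequality on the half-line, with the arithmetic mean of the variable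
replaced by its `p`-mean. The substitution `x = s ^ (1 / p)`, or `x = exp s` if `p = 0`, turns the
`p`-mean into an arithmetic one, and its Jacobian is absorbed by Hölder's inequality for means. -/
theorem powMean_lintegral_Ioi_le {p β : ℝ} {γ : EReal} (hp : p ∈ Icc (0 : ℝ) 1)
    (hγ : (β = 0 ∧ γ = 0) ∨ (0 < p ∧ HarmonicShift β p⁻¹ γ))
    {F G H : ℝ → ℝ≥0∞} (hF : Measurable F) (hG : Measurable G) (hH : Measurable H)
    (hF0 : ∫⁻ x in Ioi 0, F x ≠ 0) (hG0 : ∫⁻ x in Ioi 0, G x ≠ 0)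
    {lam : ℝ} (hlam : lam ∈ Ioo (0 : ℝ) 1)
    (hle : ∀ s t, 0 < s → 0 < t → F s ≠ 0 → G t ≠ 0 →
      powMean (β : EReal) lam (F s) (G t) ≤ H (realMean p lam s t)) :
    powMean γ lam (∫⁻ x in Ioi 0, F x) (∫⁻ x in Ioi 0, G x) ≤ ∫⁻ x in Ioi 0, H x := by
  have hlam' := Ioo_subset_Icc_self hlam
  have h1 : 0 < 1 - lam := by linarith [hlam.2]
  rcases eq_or_lt_of_le hp.1 with rfl | hp0
  -- For `p = 0` the Jacobian `exp` of the substitution is log-affine.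
  · obtain ⟨rfl, rfl⟩ : β = 0 ∧ γ = 0 := hγ.resolve_right fun h => lt_irrefl _ h.1
    refine powMean_lintegral_le_of_substitution (δ := 0) (S := univ) (φ := Real.exp)
      (φ' := Real.exp) (Or.inl ⟨rfl, rfl⟩) MeasurableSet.univ Real.measurable_exp
      Real.measurable_exp (fun x _ => (Real.hasDerivAt_exp x).hasDerivWithinAt)
      Real.exp_injective.injOn (by rw [image_univ, Real.range_exp])
      (fun x _ => (Real.exp_pos x).le) hlam (fun _ _ _ _ => mem_univ _) hF hG hH hF0 hG0
      fun s _ t _ hs ht => ?_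
    have h2 := hle _ _ (Real.exp_pos s) (Real.exp_pos t) hs ht
    rw [realMean_zero hlam', EReal.coe_zero, powMean_zero] at h2
    rw [EReal.coe_zero, powMean_zero, ENNReal.mul_rpow_of_nonneg _ _ h1.le,
      ENNReal.mul_rpow_of_nonneg _ _ hlam.1.le]
    have h3 : ENNReal.ofReal (Real.exp s) ^ (1 - lam) * ENNReal.ofReal (Real.exp t) ^ lam =
        ENNReal.ofReal (Real.exp ((1 - lam) * s + lam * t)) := by
      rw [ENNReal.ofReal_rpow_of_nonneg (Real.exp_pos _).le h1.le,
        ENNReal.ofReal_rpow_of_nonneg (Real.exp_pos _).le hlam.1.le,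
        ← ENNReal.ofReal_mul (by positivity), ← Real.exp_mul, ← Real.exp_mul, ← Real.exp_add,
        mul_comm s, mul_comm t]
    rw [← h3]
    calc _ = F (Real.exp s) ^ (1 - lam) * G (Real.exp t) ^ lam *
          (ENNReal.ofReal (Real.exp s) ^ (1 - lam) * ENNReal.ofReal (Real.exp t) ^ lam) := by ring
      _ ≤ _ := by gcongr
  -- For `p > 0` the Jacobian is a multiple of `s ^ (1 / p - 1)`: the exponent `1 / β` is first
  -- shifted by `1 / p - 1` and then by `1`.
  · replace hγ : HarmonicShift β p⁻¹ γ := hγ.elim Or.inl fun h => h.2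
    have hr : 0 ≤ p⁻¹ - 1 := by linarith [(one_le_inv₀ hp0).2 hp.2]
    obtain ⟨δ, hδ, hδγ⟩ : ∃ δ : ℝ, HarmonicShift β (p⁻¹ - 1) δ ∧ HarmonicShift δ 1 γ :=
      HarmonicShift.exists_add hr one_pos (by rwa [sub_add_cancel])
    have hpi : 0 < p⁻¹ := inv_pos.2 hp0
    have him : (fun s : ℝ => s ^ p⁻¹) '' Ioi 0 = Ioi 0 := by
      ext x
      constructor
      · rintro ⟨s, hs, rfl⟩
        exact Real.rpow_pos_of_pos hs _
      · intro hx
        exact ⟨x ^ p, Real.rpow_pos_of_pos hx _, Real.rpow_rpow_inv (le_of_lt hx) hp0.ne'⟩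
    refine powMean_lintegral_le_of_substitution (S := Ioi 0) (φ := fun s => s ^ p⁻¹)
      (φ' := fun s => p⁻¹ * s ^ (p⁻¹ - 1)) hδγ measurableSet_Ioi (by fun_prop) (by fun_prop)
      (fun x hx => (Real.hasDerivAt_rpow_const (Or.inl (ne_of_gt hx))).hasDerivWithinAt)
      ((Real.rpow_left_injOn hpi.ne').mono fun x (hx : x ∈ Ioi (0 : ℝ)) =>
        (le_of_lt hx : (0 : ℝ) ≤ x)) him
      (fun x hx => mul_nonneg hpi.le (Real.rpow_nonneg (le_of_lt hx) _)) hlam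
      (fun s hs t ht => add_pos (mul_pos h1 hs) (mul_pos hlam.1 ht)) hF hG hH hF0 hG0
      fun s hs t ht hFs hGt => ?_
    have hs0 : 0 < s := hs
    have ht0 : 0 < t := ht
    have hm0 : 0 < (1 - lam) * s + lam * t := add_pos (mul_pos h1 hs) (mul_pos hlam.1 ht)
    have h2 := hle _ _ (Real.rpow_pos_of_pos hs0 p⁻¹) (Real.rpow_pos_of_pos ht0 p⁻¹) hFs hGt
    rw [realMean_of_pos hp0 hlam' hs0 ht0] at h2
    have h3 := powMean_mul_rpow_le hr hδ hlam (a := F (s ^ p⁻¹)) (b := G (t ^ p⁻¹))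
      (c := ENNReal.ofReal s) (d := ENNReal.ofReal t) (by simpa using hs0) (by simp)
      (by simpa using ht0) (by simp)
    rw [← ENNReal.ofReal_mul h1.le, ← ENNReal.ofReal_mul hlam.1.le,
      ← ENNReal.ofReal_add (by positivity) (mul_pos hlam.1 ht).le] at h3
    have hw : ∀ x : ℝ, 0 < x → ∀ k : ℝ≥0∞, k * ENNReal.ofReal (p⁻¹ * x ^ (p⁻¹ - 1)) =
        ENNReal.ofReal p⁻¹ * (k * ENNReal.ofReal x ^ (p⁻¹ - 1)) := by
      intro x hx k
      rw [ENNReal.ofReal_mul hpi.le, ENNReal.ofReal_rpow_of_pos hx]; ring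
    rw [hw s hs0, hw t ht0, hw _ hm0, powMean_mul_left _ hlam' (by simpa using hp0) (by simp)]
    gcongr
    exact h3.trans (by gcongr)

/-! ### Antitone functions on the positive octant -/

/-- Lebesgue measure on the open positive octant, as a product of measures on half-lines. -/
noncomputable def octantMeasure (n : ℕ) : Measure (Fin n → ℝ) :=
  Measure.pi fun _ => volume.restrict (Ioi (0 : ℝ))

/-- The open positive octant. -/
def octant (n : ℕ) : Set (Fin n → ℝ) := univ.pi fun _ => Ioi 0

theorem measurableSet_octant (n : ℕ) : MeasurableSet (octant n) :=
  MeasurableSet.univ_pi fun _ => measurableSet_Ioi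

theorem octantMeasure_eq (n : ℕ) : octantMeasure n = volume.restrict (octant n) :=
  (Measure.restrict_pi_pi (fun _ => volume) fun _ => Ioi (0 : ℝ)).symm

theorem ae_mem_octant (n : ℕ) : ∀ᵐ x ∂octantMeasure n, x ∈ octant n := by
  rw [octantMeasure_eq]
  exact ae_restrict_mem (measurableSet_octant n)

theorem ordConnected_lt_indicator {α : Type*} [Preorder α] {S : Set α} (hS : S.OrdConnected)
    {f : α → ℝ≥0∞} (hf : AntitoneOn f S) (c : ℝ≥0∞) : {x | c < S.indicator f x}.OrdConnected := by
  have hmem : ∀ x, c < S.indicator f x → x ∈ S := by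
    intro x hx
    by_contra h
    rw [indicator_of_notMem h] at hx
    exact not_lt_zero hx
  refine ⟨fun x hx y hy z hz => ?_⟩
  have hzS : z ∈ S := hS.out (hmem x hx) (hmem y hy) hz
  have hyS := hmem y hy
  simp only [mem_ofPred_eq, indicator_of_mem hyS, indicator_of_mem hzS] at hy ⊢
  exact hy.trans_le (hf hzS hyS hz.2)

theorem measurable_indicator_of_antitoneOn {f : ℝ → ℝ≥0∞} (hf : AntitoneOn f (Ioi 0)) :
    Measurable ((Ioi (0 : ℝ)).indicator f) :=
  measurable_of_Ioi fun c => (ordConnected_lt_indicator ordConnected_Ioi hf c).measurableSet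

/-- Superlevel sets of an antitone function on the octant are order-connected, and order-connected
sets of `ℝⁿ` are null-measurable. -/
theorem aemeasurable_of_antitoneOn {n : ℕ} {f : (Fin n → ℝ) → ℝ≥0∞}
    (hf : AntitoneOn f (octant n)) : AEMeasurable f (octantMeasure n) := by
  have h : NullMeasurable ((octant n).indicator f) volume := by
    refine measurable_of_Ioi (δ := NullMeasurableSpace (Fin n → ℝ) volume) fun c => ?_
    exact (ordConnected_lt_indicator (ordConnected_pi fun _ _ => ordConnected_Ioi) hf
      c).nullMeasurableSet
  rw [octantMeasure_eq]
  exact (aemeasurable_indicator_iff (measurableSet_octant n)).1 h.aemeasurable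

theorem lintegral_octantMeasure_succ {n : ℕ} {f : (Fin (n + 1) → ℝ) → ℝ≥0∞}
    (hf : AEMeasurable f (octantMeasure (n + 1))) :
    ∫⁻ x, f x ∂octantMeasure (n + 1) =
      ∫⁻ s in Ioi (0 : ℝ), ∫⁻ x, f (Fin.cons s x) ∂octantMeasure n := by
  have e := (measurePreserving_piFinSuccAbove
    (fun _ : Fin (n + 1) => (volume : Measure ℝ).restrict (Ioi 0)) 0).symm
  have h1 := e.lintegral_comp_emb (MeasurableEquiv.measurableEmbedding _) f
  have h2 : AEMeasurable f
      (Measure.pi fun _ : Fin (n + 1) => (volume : Measure ℝ).restrict (Ioi 0)) := hf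
  rw [octantMeasure, ← h1]
  refine (lintegral_prod _ (h2.comp_quasiMeasurePreserving e.quasiMeasurePreserving)).trans
    (lintegral_congr fun s => lintegral_congr fun x => ?_)
  simp only [Function.comp_apply, MeasurableEquiv.piFinSuccAbove, MeasurableEquiv.symm_mk,
    MeasurableEquiv.coe_mk, Fin.insertNthEquiv_zero, Equiv.symm_symm]
  rfl

theorem cons_mem_octant {n : ℕ} {s : ℝ} (hs : 0 < s) {x : Fin n → ℝ} (hx : x ∈ octant n) :
    (Fin.cons s x : Fin (n + 1) → ℝ) ∈ octant (n + 1) := by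
  intro i _
  refine Fin.cases ?_ (fun i => ?_) i
  · simpa using hs
  · simpa using hx i (mem_univ i)

theorem cons_le_cons {n : ℕ} {s t : ℝ} (hst : s ≤ t) {x y : Fin n → ℝ} (hxy : x ≤ y) :
    (Fin.cons s x : Fin (n + 1) → ℝ) ≤ Fin.cons t y := by
  intro i
  refine Fin.cases ?_ (fun i => ?_) i
  · simpa using hst
  · simpa using hxy i

theorem antitoneOn_lintegral_cons {n : ℕ} {f : (Fin (n + 1) → ℝ) → ℝ≥0∞}
    (hf : AntitoneOn f (octant (n + 1))) :
    AntitoneOn (fun s => ∫⁻ x, f (Fin.cons s x) ∂octantMeasure n) (Ioi 0) := by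
  intro s hs t ht hst
  refine lintegral_mono_ae ?_
  filter_upwards [ae_mem_octant n] with x hx
  exact hf (cons_mem_octant hs hx) (cons_mem_octant ht hx) (cons_le_cons hst le_rfl)

/-- The Borell-Brascamp-Lieb inequality for coordinatewise `p i`-means of antitone functions on the
octant, by induction on the dimension: the integrals over the slices orthogonal to the first axis
are antitone functions to which the inequality on the half-line applies. -/
theorem powMean_lintegral_octant_le {n : ℕ} {p : Fin n → ℝ} {α : ℝ} {γ : EReal}
    (hp : ∀ i, p i ∈ Icc (0 : ℝ) 1)
    (hγ : (α = 0 ∧ γ = 0) ∨ ((∀ i, 0 < p i) ∧ HarmonicShift α (∑ i, (p i)⁻¹) γ))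
    {f g h : (Fin n → ℝ) → ℝ≥0∞} (hf : AntitoneOn f (octant n)) (hg : AntitoneOn g (octant n))
    (hh : AntitoneOn h (octant n)) (hf0 : ∫⁻ x, f x ∂octantMeasure n ≠ 0)
    (hg0 : ∫⁻ x, g x ∂octantMeasure n ≠ 0) {lam : ℝ} (hlam : lam ∈ Ioo (0 : ℝ) 1)
    (hle : ∀ x ∈ octant n, ∀ y ∈ octant n, f x ≠ 0 → g y ≠ 0 →
      powMean (α : EReal) lam (f x) (g y) ≤ h fun i => realMean (p i) lam (x i) (y i)) :
    powMean γ lam (∫⁻ x, f x ∂octantMeasure n) (∫⁻ x, g x ∂octantMeasure n) ≤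
      ∫⁻ x, h x ∂octantMeasure n := by
  induction n generalizing γ with
  | zero =>
    have hγα : γ = α := by
      rcases hγ with ⟨rfl, rfl⟩ | ⟨_, hγ⟩
      · rfl
      · rcases hγ with ⟨rfl, rfl⟩ | ⟨_, hγ⟩ | ⟨_, _, hγ⟩ | ⟨h1, h2, _⟩
        · rfl
        · simpa using hγ
        · simpa using hγ
        · simp only [Finset.univ_eq_empty, Finset.sum_empty, add_zero, inv_eq_zero] at h2
          exact absurd h2 h1.ne
    have hint : ∀ k : (Fin 0 → ℝ) → ℝ≥0∞, ∫⁻ x, k x ∂octantMeasure 0 = k 0 := by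
      intro k
      rw [octantMeasure, Measure.pi_of_empty (fun _ => (volume : Measure ℝ).restrict (Ioi 0)) 0,
        lintegral_dirac]
    rw [hint] at hf0 hg0
    rw [hint, hint, hint, hγα]
    refine (hle 0 (fun i => i.elim0) 0 (fun i => i.elim0) hf0 hg0).trans (le_of_eq ?_)
    congr 1
    exact Subsingleton.elim _ _
  | succ n ih =>
    obtain ⟨β, hβ, hβγ⟩ : ∃ β : ℝ,
        ((α = 0 ∧ (β : EReal) = 0) ∨
          ((∀ i : Fin n, 0 < p i.succ) ∧ HarmonicShift α (∑ i : Fin n, (p i.succ)⁻¹) β)) ∧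
        ((β = 0 ∧ γ = 0) ∨ (0 < p 0 ∧ HarmonicShift β (p 0)⁻¹ γ)) := by
      rcases hγ with ⟨hα, hγ⟩ | ⟨hpos, hγ⟩
      · exact ⟨0, Or.inl ⟨hα, rfl⟩, Or.inl ⟨rfl, hγ⟩⟩
      · rw [Fin.sum_univ_succ, add_comm] at hγ
        obtain ⟨β, h1, h2⟩ := HarmonicShift.exists_add
          (Finset.sum_nonneg fun i _ => (inv_pos.2 (hpos i.succ)).le) (inv_pos.2 (hpos 0)) hγ
        exact ⟨β, Or.inr ⟨fun i => hpos i.succ, h1⟩, Or.inr ⟨hpos 0, h2⟩⟩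
    let I : ((Fin (n + 1) → ℝ) → ℝ≥0∞) → ℝ → ℝ≥0∞ := fun k =>
      (Ioi (0 : ℝ)).indicator fun s => ∫⁻ x, k (Fin.cons s x) ∂octantMeasure n
    have hI : ∀ k, AntitoneOn k (octant (n + 1)) →
        ∫⁻ x, k x ∂octantMeasure (n + 1) = ∫⁻ s in Ioi (0 : ℝ), I k s := by
      intro k hk
      rw [lintegral_octantMeasure_succ (aemeasurable_of_antitoneOn hk)]
      exact setLIntegral_congr_fun measurableSet_Ioi fun s hs => (indicator_of_mem hs
        fun s => ∫⁻ x, k (Fin.cons s x) ∂octantMeasure n).symm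
    have hIm : ∀ k, AntitoneOn k (octant (n + 1)) → Measurable (I k) := fun k hk =>
      measurable_indicator_of_antitoneOn (antitoneOn_lintegral_cons hk)
    have hslice : ∀ k : (Fin (n + 1) → ℝ) → ℝ≥0∞, AntitoneOn k (octant (n + 1)) → ∀ s : ℝ, 0 < s →
        AntitoneOn (fun x : Fin n → ℝ => k (Fin.cons s x)) (octant n) :=
      fun k hk s hs x hx y hy hxy => hk (cons_mem_octant hs hx) (cons_mem_octant hs hy)
        (cons_le_cons (le_refl s) hxy)
    rw [hI f hf] at hf0
    rw [hI g hg] at hg0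
    rw [hI f hf, hI g hg, hI h hh]
    refine powMean_lintegral_Ioi_le (hp 0) hβγ (hIm f hf) (hIm g hg) (hIm h hh) hf0 hg0 hlam
      fun s t hs ht hs0 ht0 => ?_
    have hm : 0 < realMean (p 0) lam s t := realMean_pos _ hlam hs ht
    simp only [I, indicator_of_mem (show s ∈ Ioi (0 : ℝ) from hs),
      indicator_of_mem (show t ∈ Ioi (0 : ℝ) from ht),
      indicator_of_mem (show realMean (p 0) lam s t ∈ Ioi (0 : ℝ) from hm)] at hs0 ht0 ⊢
    refine ih (p := fun i => p i.succ) (fun i => hp i.succ) hβ (hslice f hf s hs)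
      (hslice g hg t ht) (hslice h hh _ hm) hs0 ht0 fun x hx y hy hfx hgy => ?_
    refine (hle _ (cons_mem_octant hs hx) _ (cons_mem_octant ht hy) hfx hgy).trans (le_of_eq ?_)
    congr 1
    funext i
    refine Fin.cases ?_ (fun i => ?_) i <;> simp

/-! ### Unconditional sets, measures and densities -/

theorem IsSign.mul_self {n : ℕ} {ε : Fin n → ℝ} (hε : IsSign ε) : ε * ε = 1 := by
  funext i
  rcases hε i with h | h <;> simp [h]

theorem IsSign.abs_mul {n : ℕ} {ε : Fin n → ℝ} (hε : IsSign ε) (x : Fin n → ℝ) (i : Fin n) :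
    |(ε * x) i| = |x i| := by
  rcases hε i with h | h <;> simp [h]

instance finite_isSign (n : ℕ) : Finite {ε : Fin n → ℝ // IsSign ε} := by
  have : {ε : Fin n → ℝ | ∀ i, ε i ∈ ({1, -1} : Set ℝ)}.Finite :=
    Set.Finite.pi' fun _ => Set.toFinite _
  exact this.to_subtype

instance nonempty_isSign (n : ℕ) : Nonempty {ε : Fin n → ℝ // IsSign ε} :=
  ⟨⟨1, fun _ => Or.inl rfl⟩⟩

/-- The reflection of `ℝⁿ` given by a sign vector. -/
def signEquiv {n : ℕ} {ε : Fin n → ℝ} (hε : IsSign ε) : (Fin n → ℝ) ≃ᵐ (Fin n → ℝ) :=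
  MeasurableEquiv.ofInvolutive (fun x => ε * x)
    (fun x => by simp [← mul_assoc, hε.mul_self]) (measurable_const_mul ε)

theorem measurePreserving_sign {n : ℕ} {ε : Fin n → ℝ} (hε : IsSign ε) :
    MeasurePreserving (fun x : Fin n → ℝ => ε * x) volume volume := by
  refine volume_preserving_pi (f := fun i x => ε i * x) fun i => ?_
  rcases hε i with h | h
  · simp only [h, one_mul]
    exact MeasurePreserving.id _
  · simpa [h] using Measure.measurePreserving_neg (volume : Measure ℝ)

/-- The box with vertices `(± y i)` is the convex hull of its vertices. -/
theorem mem_of_forall_sign_mul_mem {n : ℕ} {K : Set (Fin n → ℝ)} (hK : Convex ℝ K)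
    {x y : Fin n → ℝ} (hy : ∀ ε, IsSign ε → ε * y ∈ K) (hxy : ∀ i, |x i| ≤ |y i|) : x ∈ K := by
  have h1 : x ∈ univ.pi fun i => convexHull ℝ ({-|y i|, |y i|} : Set ℝ) := by
    intro i _
    beta_reduce
    rw [convexHull_pair, segment_eq_Icc (by linarith [abs_nonneg (y i)])]
    exact abs_le.1 (hxy i)
  rw [← convexHull_pi] at h1
  refine convexHull_min ?_ hK h1
  intro z hz
  classical
  let ε : Fin n → ℝ := fun i => if z i = y i then 1 else -1
  have h2 : ε * y = z := by
    funext i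
    by_cases h : z i = y i
    · simp [ε, h]
    · simp only [ε, Pi.mul_apply, if_neg h]
      rcases hz i (mem_univ i) with h' | h' <;>
        rcases abs_choice (y i) with h'' | h'' <;> rw [h''] at h' <;> grind
  rw [← h2]
  refine hy ε fun i => ?_
  by_cases h : z i = y i <;> simp [ε, h]

theorem IsUnconditionalSet.mem_of_abs_le {n : ℕ} {A : Set (Fin n → ℝ)} (hA : IsUnconditionalSet A)
    (hc : Convex ℝ A) {x y : Fin n → ℝ} (hy : y ∈ A) (hxy : ∀ i, |x i| ≤ |y i|) : x ∈ A :=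
  mem_of_forall_sign_mul_mem hc (fun ε hε => (hA ε hε y).2 hy) hxy

theorem volume_compl_iUnion_orthant (n : ℕ) :
    volume (⋃ ε : {ε : Fin n → ℝ // IsSign ε}, {x | ε.1 * x ∈ octant n})ᶜ = 0 := by
  have h : ∀ᵐ x : Fin n → ℝ, ∀ i, x i ≠ 0 :=
    ae_all_iff.2 fun i => Measure.ae_eval_ne (fun _ : Fin n => (volume : Measure ℝ)) i 0
  refine measure_mono_null ?_ (ae_iff.1 h)
  intro x hx hx'
  apply hx
  refine mem_iUnion.2 ⟨⟨fun i => SignType.sign (x i), fun i => ?_⟩, fun i _ => ?_⟩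
  · rcases lt_or_gt_of_ne (hx' i) with h | h <;> simp [h]
  · rcases lt_or_gt_of_ne (hx' i) with h | h <;> simp [h]

/-- An unconditional set splits into its pieces in the `2 ^ n` open orthants, up to a null set. It
need not be measurable, as the orthants are. -/
theorem IsUnconditionalMeasure.measure_eq {n : ℕ} {μ : Measure (Fin n → ℝ)}
    (hμ : IsUnconditionalMeasure μ) (hac : μ ≪ volume) {S : Set (Fin n → ℝ)}
    (hS : IsUnconditionalSet S) :
    μ S = Nat.card {ε : Fin n → ℝ // IsSign ε} * μ (octant n ∩ S) := by
  have hmeas : ∀ ε : {ε : Fin n → ℝ // IsSign ε}, MeasurableSet {x | ε.1 * x ∈ octant n} :=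
    fun ε => measurable_const_mul ε.1 (measurableSet_octant n)
  have hdisj : Pairwise (Function.onFun Disjoint
      fun ε : {ε : Fin n → ℝ // IsSign ε} => {x | ε.1 * x ∈ octant n}) := by
    intro ε ε' hne
    refine Set.disjoint_left.2 fun x hx hx' => hne (Subtype.ext (funext fun i => ?_))
    have h1 : 0 < ε.1 i * x i := hx i (mem_univ i)
    have h2 : 0 < ε'.1 i * x i := hx' i (mem_univ i)
    rcases ε.2 i with h | h <;> rcases ε'.2 i with h' | h' <;> rw [h] at h1 ⊢ <;>
      rw [h'] at h2 ⊢ <;> linarith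
  have hpiece : ∀ ε : {ε : Fin n → ℝ // IsSign ε},
      μ.restrict S {x | ε.1 * x ∈ octant n} = μ (octant n ∩ S) := by
    intro ε
    rw [Measure.restrict_apply (hmeas ε)]
    conv_rhs => rw [← hμ ε.1 ε.2]
    refine Eq.trans ?_ ((signEquiv ε.2).map_apply _).symm
    congr 1
    ext x
    exact and_congr Iff.rfl (hS ε.1 ε.2 x).symm
  have h0 : μ.restrict S (⋃ ε : {ε : Fin n → ℝ // IsSign ε}, {x | ε.1 * x ∈ octant n})ᶜ = 0 :=
    (Measure.restrict_le_self.absolutelyContinuous.trans hac) (volume_compl_iUnion_orthant n)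
  have := measure_iUnion (μ := μ.restrict S) hdisj hmeas
  calc μ S = μ.restrict S univ := by simp
    _ = μ.restrict S (⋃ ε : {ε : Fin n → ℝ // IsSign ε}, {x | ε.1 * x ∈ octant n}) := by
      rw [← measure_add_measure_compl (MeasurableSet.iUnion hmeas), h0, add_zero]
    _ = _ := by
      rw [this]
      simp only [hpiece]
      have := Fintype.ofFinite {ε : Fin n → ℝ // IsSign ε}
      rw [tsum_fintype]
      simp

/-- The smallest value of a function on the orbit of a point under the coordinate reflections. -/
noncomputable def signInf {n : ℕ} (f : (Fin n → ℝ) → ℝ≥0) (x : Fin n → ℝ) : ℝ≥0 :=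
  ⨅ ε : {ε : Fin n → ℝ // IsSign ε}, f (ε.1 * x)

theorem signInf_le {n : ℕ} (f : (Fin n → ℝ) → ℝ≥0) (x : Fin n → ℝ) {ε : Fin n → ℝ}
    (hε : IsSign ε) : signInf f x ≤ f (ε * x) :=
  ciInf_le (OrderBot.bddBelow _) (⟨ε, hε⟩ : {ε : Fin n → ℝ // IsSign ε})

theorem exists_signInf_eq {n : ℕ} (f : (Fin n → ℝ) → ℝ≥0) (x : Fin n → ℝ) :
    ∃ ε, IsSign ε ∧ f (ε * x) = signInf f x := by
  obtain ⟨ε, hε⟩ := exists_eq_ciInf_of_finite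
    (f := fun ε : {ε : Fin n → ℝ // IsSign ε} => f (ε.1 * x))
  exact ⟨ε.1, ε.2, hε⟩

theorem IsAlphaConcave.signInf {n : ℕ} {α : EReal} {f : (Fin n → ℝ) → ℝ≥0}
    (hf : IsAlphaConcave α f) : IsAlphaConcave α (signInf f) := by
  intro x y hxy lam hlam
  obtain ⟨ε, hε, h⟩ := exists_signInf_eq f ((1 - lam) • x + lam • y)
  have hx := signInf_le f x hε
  have hy := signInf_le f y hε
  have hlin : ε * ((1 - lam) • x + lam • y) = (1 - lam) • (ε * x) + lam • (ε * y) := by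
    rw [mul_add, mul_smul_comm, mul_smul_comm]
  rw [← h, hlin]
  refine (powMean_mono α hlam (ENNReal.coe_le_coe.2 hx) (ENNReal.coe_le_coe.2 hy)).trans
    (hf _ _ (hxy.trans_le (mul_le_mul' hx hy)) lam hlam)

theorem IsAlphaConcave.convex_le {n : ℕ} {α : EReal} {f : (Fin n → ℝ) → ℝ≥0}
    (hf : IsAlphaConcave α f) {c : ℝ≥0} (hc : 0 < c) : Convex ℝ {x | c ≤ f x} := by
  rw [convex_iff_forall_pos]
  intro x (hx : c ≤ f x) y (hy : c ≤ f y) a b ha hb hab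
  have hb' : b ∈ Icc (0 : ℝ) 1 := ⟨hb.le, by linarith⟩
  obtain rfl : a = 1 - b := by linarith
  have h := hf x y (mul_pos (hc.trans_le hx) (hc.trans_le hy)) b hb'
  have h2 := (powMean_mono α hb' (ENNReal.coe_le_coe.2 hx) (ENNReal.coe_le_coe.2 hy)).trans h
  rw [powMean_self α hb'] at h2
  exact ENNReal.coe_le_coe.1 h2

theorem IsAlphaConcave.signInf_le_of_abs_le {n : ℕ} {α : EReal} {f : (Fin n → ℝ) → ℝ≥0}
    (hf : IsAlphaConcave α f) {x y : Fin n → ℝ} (hxy : ∀ i, |x i| ≤ |y i|) :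
    LpBM.signInf f y ≤ LpBM.signInf f x := by
  rcases eq_or_lt_of_le (zero_le (a := LpBM.signInf f y)) with h0 | h0
  · rw [← h0]; exact zero_le
  obtain ⟨ε, hε, h⟩ := exists_signInf_eq f x
  rw [← h]
  exact mem_of_forall_sign_mul_mem (hf.convex_le h0) (fun ε' hε' => signInf_le f y hε')
    fun i => by rw [hε.abs_mul]; exact hxy i

/-- The density of an unconditional measure is unconditional only almost everywhere; `signInf f` is
an exactly unconditional version of it. -/
theorem ae_eq_signInf {n : ℕ} {f : (Fin n → ℝ) → ℝ≥0} (hf : AEMeasurable f volume)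
    (hμ : IsUnconditionalMeasure
      ((volume : Measure (Fin n → ℝ)).withDensity fun x => (f x : ℝ≥0∞))) :
    (fun x => (f x : ℝ≥0∞)) =ᵐ[volume] fun x => (signInf f x : ℝ≥0∞) := by
  have key : ∀ ε : {ε : Fin n → ℝ // IsSign ε},
      (fun x => (f (ε.1 * x) : ℝ≥0∞)) =ᵐ[volume] fun x => (f x : ℝ≥0∞) := by
    intro ε
    have hp := measurePreserving_sign ε.2
    refine ae_eq_of_forall_setLIntegral_eq_of_sigmaFinite₀
      (hf.comp_quasiMeasurePreserving hp.quasiMeasurePreserving).coe_nnreal_ennreal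
      hf.coe_nnreal_ennreal fun s hs _ => ?_
    have h1 := hp.setLIntegral_comp_preimage_emb (signEquiv ε.2).measurableEmbedding
      (fun x => (f x : ℝ≥0∞)) ((fun x => ε.1 * x) ⁻¹' s)
    have h2 : (fun x => ε.1 * x) ⁻¹' ((fun x => ε.1 * x) ⁻¹' s) = s := by
      ext x
      simp [← mul_assoc, ε.2.mul_self]
    have hs' : MeasurableSet ((fun x : Fin n → ℝ => ε.1 * x) ⁻¹' s) := hp.measurable hs
    rw [h2] at h1
    rw [h1, ← withDensity_apply _ hs', ← withDensity_apply _ hs,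
      ← Measure.map_apply hp.measurable hs, hμ ε.1 ε.2]
  filter_upwards [ae_all_iff.2 key] with x hx
  obtain ⟨ε, hε, h⟩ := exists_signInf_eq f x
  rw [← h]
  exact (hx ⟨ε, hε⟩).symm

theorem isOpen_octant (n : ℕ) : IsOpen (octant n) :=
  isOpen_set_pi finite_univ fun _ _ => isOpen_Ioi

theorem lintegral_indicator_octant_ne_zero {n : ℕ} {A : Set (Fin n → ℝ)}
    (hA : (0 : Fin n → ℝ) ∈ interior A) {g : (Fin n → ℝ) → ℝ≥0∞} (hg : AntitoneOn g (octant n))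
    {x : Fin n → ℝ} (hx : x ∈ octant n) (hgx : g x ≠ 0) :
    ∫⁻ y, A.indicator g y ∂octantMeasure n ≠ 0 := by
  set U : Set (Fin n → ℝ) := interior A ∩ octant n ∩ univ.pi fun i => Iio (x i) with hU
  have hUo : IsOpen U := (isOpen_interior.inter (isOpen_octant n)).inter
    (isOpen_set_pi finite_univ fun _ _ => isOpen_Iio)
  have hUne : U.Nonempty := by
    have ht : Tendsto (fun t : ℝ => t • x) (𝓝[>] 0) (𝓝 0) := by
      have : Tendsto (fun t : ℝ => t • x) (𝓝 0) (𝓝 ((0 : ℝ) • x)) :=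
        (continuous_id.smul continuous_const).tendsto 0
      rw [zero_smul] at this
      exact this.mono_left nhdsWithin_le_nhds
    have h1 : ∀ᶠ t : ℝ in 𝓝[>] 0, t • x ∈ interior A := ht (isOpen_interior.mem_nhds hA)
    have h2 : ∀ᶠ t : ℝ in 𝓝[>] 0, t ∈ Ioo (0 : ℝ) 1 := Ioo_mem_nhdsGT one_pos
    obtain ⟨t, ht1, ht2⟩ := (h1.and h2).exists
    refine ⟨t • x, ⟨ht1, fun i _ => mul_pos ht2.1 (hx i (mem_univ i))⟩, fun i _ => ?_⟩
    exact mul_lt_of_lt_one_left (hx i (mem_univ i)) ht2.2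
  have hUv : volume U ≠ 0 := (hUo.measure_pos volume hUne).ne'
  have hle : g x * volume U ≤ ∫⁻ y, A.indicator g y ∂octantMeasure n := by
    rw [octantMeasure_eq, ← setLIntegral_const]
    calc ∫⁻ _ in U, g x ≤ ∫⁻ y in U, A.indicator g y := by
          refine setLIntegral_mono' hUo.measurableSet fun y hy => ?_
          rw [indicator_of_mem (interior_subset hy.1.1)]
          exact hg hy.1.2 hx fun i => le_of_lt (hy.2 i (mem_univ i))
      _ ≤ _ := lintegral_mono_set fun y hy => hy.1.2
  intro h0
  rw [h0] at hle
  exact mul_ne_zero hgx hUv (le_antisymm hle zero_le)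

/-- On the octant, `(1 - lam) · A +_p lam · B` is a lower set: the coordinate means are homogeneous,
so the coordinates of the two points can be scaled down separately. -/
theorem mem_pCombination_of_le {n : ℕ} {p : Fin n → ℝ} {A B : Set (Fin n → ℝ)}
    (hA : Convex ℝ A) (hAu : IsUnconditionalSet A) (hB : Convex ℝ B) (hBu : IsUnconditionalSet B)
    {lam : ℝ} (hlam : lam ∈ Icc (0 : ℝ) 1) {x y : Fin n → ℝ} (hx : x ∈ octant n) (hxy : x ≤ y)
    (hy : y ∈ pCombination (fun i => (p i : EReal)) lam A B) :
    x ∈ pCombination (fun i => (p i : EReal)) lam A B := by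
  obtain ⟨a, ha, b, hb, ha0, hb0, hab⟩ := hy
  have hx0 : ∀ i, 0 < x i := fun i => hx i (mem_univ i)
  have hy0 : ∀ i, 0 < y i := fun i => (hx0 i).trans_le (hxy i)
  have ht0 : ∀ i, 0 < x i / y i := fun i => div_pos (hx0 i) (hy0 i)
  have ht1 : ∀ i, x i / y i ≤ 1 := fun i => (div_le_one (hy0 i)).2 (hxy i)
  have hle : ∀ c : Fin n → ℝ, 0 ≤ c → ∀ i, |x i / y i * c i| ≤ |c i| := by
    intro c hc i
    rw [abs_mul, abs_of_pos (ht0 i)]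
    exact mul_le_of_le_one_left (abs_nonneg _) (ht1 i)
  refine ⟨fun i => x i / y i * a i, hAu.mem_of_abs_le hA ha (hle a ha0),
    fun i => x i / y i * b i, hBu.mem_of_abs_le hB hb (hle b hb0),
    fun i => mul_nonneg (ht0 i).le (ha0 i), fun i => mul_nonneg (ht0 i).le (hb0 i), ?_⟩
  funext i
  have h := congrFun hab i
  simp only [pMeanPoint] at h ⊢
  rw [ENNReal.ofReal_mul (ht0 i).le, ENNReal.ofReal_mul (ht0 i).le,
    powMean_mul_left _ hlam (by simpa using ht0 i) (by simp), ENNReal.toReal_mul, ← h,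
    ENNReal.toReal_ofReal (ht0 i).le, abs_of_pos (hx0 i), abs_of_pos (hy0 i),
    div_mul_cancel₀ _ (hy0 i).ne']

theorem realMean_le {p : ℝ} (hp : p ∈ Icc (0 : ℝ) 1) {lam : ℝ} (hlam : lam ∈ Icc (0 : ℝ) 1)
    {s t : ℝ} (hs : 0 ≤ s) (ht : 0 ≤ t) : realMean p lam s t ≤ (1 - lam) * s + lam * t := by
  have h1 : 0 ≤ 1 - lam := by linarith [hlam.2]
  refine ENNReal.toReal_le_of_le_ofReal (add_nonneg (mul_nonneg h1 hs) (mul_nonneg hlam.1 ht)) ?_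
  rw [ENNReal.ofReal_add (mul_nonneg h1 hs) (mul_nonneg hlam.1 ht), ENNReal.ofReal_mul h1,
    ENNReal.ofReal_mul hlam.1]
  exact powMean_le_powMean_one hp hlam _ _

theorem sumInv_eq_top {n : ℕ} {p : Fin n → ℝ} {i : Fin n} (hi : p i = 0) : sumInv p = ⊤ :=
  ENNReal.sum_eq_top.2 ⟨i, Finset.mem_univ i, by simp [hi]⟩

theorem sumInv_eq_ofReal {n : ℕ} {p : Fin n → ℝ} (hp : ∀ i, 0 < p i) :
    sumInv p = ENNReal.ofReal (∑ i, (p i)⁻¹) := by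
  rw [sumInv, ENNReal.ofReal_sum_of_nonneg fun i _ => (inv_pos.2 (hp i)).le]
  exact Finset.sum_congr rfl fun i _ => (ENNReal.ofReal_inv_of_pos (hp i)).symm

/-- The definition of `γ` and the lower bound on `α` in terms of `HarmonicShift`. If some `p i`
vanishes, then `α ≥ 0` and `γ = 0`, and `α` may be lowered to `0`. -/
theorem exists_exponent {n : ℕ} {p : Fin n → ℝ} (hp : ∀ i, p i ∈ Icc (0 : ℝ) 1) {α : ℝ}
    (hα : -(((sumInv p)⁻¹ : ℝ≥0∞) : EReal) ≤ (α : EReal)) :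
    ∃ α' : ℝ, (∀ lam ∈ Icc (0 : ℝ) 1, ∀ a b, powMean α' lam a b ≤ powMean α lam a b) ∧
      ((α' = 0 ∧ gammaExp p α = 0) ∨
        ((∀ i, 0 < p i) ∧ HarmonicShift α' (∑ i, (p i)⁻¹) (gammaExp p α))) := by
  by_cases h : ∃ i, p i = 0
  · obtain ⟨i, hi⟩ := h
    have htop := sumInv_eq_top hi
    rw [htop] at hα
    simp only [ENNReal.inv_top, EReal.coe_ennreal_zero, neg_zero] at hα
    have hα0 : 0 ≤ α := by exact_mod_cast hα
    exact ⟨0, fun lam hlam a b => powMean_zero_le_powMean hα0 hlam a b,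
      Or.inl ⟨rfl, by simp [gammaExp, htop]⟩⟩
  · have hpos : ∀ i, 0 < p i := fun i => (hp i).1.lt_of_ne fun hi => h ⟨i, hi.symm⟩
    have hsum := sumInv_eq_ofReal hpos
    set S := ∑ i, (p i)⁻¹ with hS
    have hS0 : 0 ≤ S := Finset.sum_nonneg fun i _ => (inv_pos.2 (hpos i)).le
    refine ⟨α, fun _ _ _ _ => le_rfl, Or.inr ⟨hpos, ?_⟩⟩
    have hne : sumInv p ≠ ⊤ := by rw [hsum]; simp
    have htoReal : (sumInv p).toReal = S := by rw [hsum, ENNReal.toReal_ofReal hS0]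
    rcases lt_trichotomy α 0 with hα0 | rfl | hα0
    · have hle : α⁻¹ + S ≤ 0 := by
        rcases eq_or_lt_of_le hS0 with h0 | h0
        · rw [← h0, add_zero]; exact inv_nonpos.2 hα0.le
        · rw [hsum, ← ENNReal.ofReal_inv_of_pos h0, EReal.coe_ennreal_ofReal,
            max_eq_left (inv_pos.2 h0).le, ← EReal.coe_neg, EReal.coe_le_coe_iff] at hα
          have h1 : (-α) ≤ S⁻¹ := by linarith
          have h2 := (le_inv_comm₀ (neg_pos.2 hα0) h0).1 h1
          rw [inv_neg] at h2
          linarith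
      rcases eq_or_lt_of_le hle with h0 | h0
      · refine Or.inr (Or.inr (Or.inr ⟨hα0, h0, ?_⟩))
        rw [gammaExp, if_neg (by simp [hne, hα0.ne]), htoReal, if_pos (by linarith)]
      · refine Or.inr (Or.inr (Or.inl ⟨hα0, h0, ?_⟩))
        rw [gammaExp, if_neg (by simp [hne, hα0.ne]), htoReal, if_neg (by linarith), add_comm S]
    · exact Or.inl ⟨rfl, by simp [gammaExp]⟩
    · have : 0 < α⁻¹ := inv_pos.2 hα0
      refine Or.inr (Or.inl ⟨hα0, ?_⟩)
      rw [gammaExp, if_neg (by simp [hne, hα0.ne']), htoReal, if_neg (by linarith), add_comm S]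

theorem gammaExp_ne_top {n : ℕ} (p : Fin n → ℝ) (α : ℝ) : gammaExp p α ≠ ⊤ := by
  unfold gammaExp
  split_ifs <;> simp

theorem abs_mem_of_mem {n : ℕ} {A : Set (Fin n → ℝ)} (hA : IsUnconditionalSet A)
    (hc : Convex ℝ A) {x : Fin n → ℝ} (hx : x ∈ A) : (fun i => |x i|) ∈ A :=
  hA.mem_of_abs_le hc hx fun i => by simp

theorem subset_pCombination_zero {n : ℕ} (p : Fin n → ℝ) {A B : Set (Fin n → ℝ)}
    (hA : Convex ℝ A) (hAu : IsUnconditionalSet A) (hB : (0 : Fin n → ℝ) ∈ B) :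
    A ⊆ pCombination (fun i => (p i : EReal)) 0 A B := by
  intro x hx
  refine ⟨_, abs_mem_of_mem hAu hA hx, 0, hB, fun i => abs_nonneg _, le_rfl, ?_⟩
  funext i
  rw [pMeanPoint, powMean_coe_weight_zero, ENNReal.toReal_ofReal (abs_nonneg _)]

theorem subset_pCombination_one {n : ℕ} (p : Fin n → ℝ) {A B : Set (Fin n → ℝ)}
    (hB : Convex ℝ B) (hBu : IsUnconditionalSet B) (hA : (0 : Fin n → ℝ) ∈ A) :
    B ⊆ pCombination (fun i => (p i : EReal)) 1 A B := by
  intro x hx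
  refine ⟨0, hA, _, abs_mem_of_mem hBu hB hx, le_rfl, fun i => abs_nonneg _, ?_⟩
  funext i
  rw [pMeanPoint, powMean_coe_weight_one, ENNReal.toReal_ofReal (abs_nonneg _)]

theorem antitoneOn_indicator {n : ℕ} {S : Set (Fin n → ℝ)} {g : (Fin n → ℝ) → ℝ≥0∞}
    (hg : AntitoneOn g (octant n)) (hS : ∀ x ∈ octant n, ∀ y ∈ S, x ≤ y → x ∈ S) :
    AntitoneOn (S.indicator g) (octant n) := by
  intro x hx y hy hxy
  by_cases h : y ∈ S
  · rw [indicator_of_mem h, indicator_of_mem (hS x hx y h hxy)]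
    exact hg hx hy hxy
  · rw [indicator_of_notMem h]
    exact zero_le

theorem IsUnconditionalSet.mem_of_mem_octant_of_le {n : ℕ} {A : Set (Fin n → ℝ)}
    (hA : IsUnconditionalSet A) (hc : Convex ℝ A) :
    ∀ x ∈ octant n, ∀ y ∈ A, x ≤ y → x ∈ A := fun x hx y hy hxy =>
  hA.mem_of_abs_le hc hy fun i => by
    rw [abs_of_pos (hx i (mem_univ i))]
    exact (hxy i).trans (le_abs_self _)

theorem powMean_measure_le_of_mem_Ioo {n : ℕ} {p : Fin n → ℝ} (hp : ∀ i, p i ∈ Icc (0 : ℝ) 1)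
    {α : ℝ} (hα : -(((sumInv p)⁻¹ : ℝ≥0∞) : EReal) ≤ (α : EReal))
    {μ : Measure (Fin n → ℝ)} (hμ : IsUnconditionalMeasure μ)
    (hμd : HasAlphaConcaveDensity (α : EReal) μ) {A B : Set (Fin n → ℝ)}
    (hA : IsConvexBody A) (hAu : IsUnconditionalSet A)
    (hB : IsConvexBody B) (hBu : IsUnconditionalSet B)
    {lam : ℝ} (hlam : lam ∈ Ioo (0 : ℝ) 1) :
    powMean (gammaExp p α) lam (μ A) (μ B) ≤
      μ (pCombination (fun i => (p i : EReal)) lam A B) := by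
  have hlam' := Ioo_subset_Icc_self hlam
  obtain ⟨f, hfm, hf, rfl⟩ := hμd
  obtain ⟨α', hα', hγ⟩ := exists_exponent hp hα
  set C := pCombination (fun i => (p i : EReal)) lam A B with hC
  let g : (Fin n → ℝ) → ℝ≥0∞ := fun x => signInf f x
  have hfg := ae_eq_signInf hfm hμ
  have hg : AntitoneOn g (octant n) := fun x hx y hy hxy =>
    ENNReal.coe_le_coe.2 <| hf.signInf_le_of_abs_le fun i => by
      rw [abs_of_pos (hx i (mem_univ i)), abs_of_pos (hy i (mem_univ i))]
      exact hxy i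
  have hac : (volume : Measure (Fin n → ℝ)).withDensity (fun x => (f x : ℝ≥0∞)) ≪ volume :=
    withDensity_absolutelyContinuous _ _
  have hle : ∀ S : Set (Fin n → ℝ), ∫⁻ x, S.indicator g x ∂octantMeasure n ≤
      volume.withDensity (fun x => (f x : ℝ≥0∞)) (octant n ∩ S) := by
    intro S
    rw [withDensity_congr_ae hfg, octantMeasure_eq, inter_comm]
    refine (lintegral_indicator_le _ _).trans ?_
    rw [Measure.restrict_restrict' (measurableSet_octant n)]
    exact withDensity_apply_le _ _
  have heq : ∀ S : Set (Fin n → ℝ), MeasurableSet S →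
      volume.withDensity (fun x => (f x : ℝ≥0∞)) (octant n ∩ S) =
        ∫⁻ x, S.indicator g x ∂octantMeasure n := by
    intro S hS
    rw [withDensity_congr_ae hfg, withDensity_apply _ ((measurableSet_octant n).inter hS),
      octantMeasure_eq, lintegral_indicator hS, Measure.restrict_restrict hS, inter_comm]
  set c : ℝ≥0∞ := (Nat.card {ε : Fin n → ℝ // IsSign ε} : ℝ≥0∞) with hc
  have hc0 : c ≠ 0 := by simpa [hc] using Nat.card_pos.ne'
  have hc1 : c ≠ ∞ := ENNReal.natCast_ne_top _
  rw [hμ.measure_eq hac hAu, hμ.measure_eq hac hBu,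
    hμ.measure_eq hac (isUnconditionalSet_pCombination _ _ _ _), powMean_mul_left _ hlam' hc0 hc1,
    heq A hA.isCompact.measurableSet, heq B hB.isCompact.measurableSet]
  refine mul_le_mul_right (le_trans ?_ (hle C)) c
  -- The octant inequality needs positive integrals: either the density vanishes on the octant, or it
  -- is bounded below near the origin, which is interior to `A` and `B`.
  by_cases hzero : ∀ x ∈ octant n, g x = 0
  · have h0 : ∀ S : Set (Fin n → ℝ), ∫⁻ x, S.indicator g x ∂octantMeasure n = 0 := by
      intro S
      rw [← lintegral_zero (μ := octantMeasure n)]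
      refine lintegral_congr_ae ?_
      filter_upwards [ae_mem_octant n] with x hx
      by_cases hxS : x ∈ S
      · rw [indicator_of_mem hxS, hzero x hx]
      · exact indicator_of_notMem hxS _
    rw [h0, h0, powMean_self _ hlam']
    exact zero_le
  · push Not at hzero
    obtain ⟨x₀, hx₀, hgx₀⟩ := hzero
    refine powMean_lintegral_octant_le hp hγ
      (antitoneOn_indicator hg (hAu.mem_of_mem_octant_of_le hA.convex))
      (antitoneOn_indicator hg (hBu.mem_of_mem_octant_of_le hB.convex))
      (antitoneOn_indicator hg fun x hx y hy hxy =>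
        mem_pCombination_of_le hA.convex hAu hB.convex hBu hlam' hx hxy hy)
      (lintegral_indicator_octant_ne_zero hA.zero_mem_interior hg hx₀ hgx₀)
      (lintegral_indicator_octant_ne_zero hB.zero_mem_interior hg hx₀ hgx₀) hlam
      fun x hx y hy hfx hfy => ?_
    have hxA : x ∈ A := by
      by_contra h
      exact hfx (indicator_of_notMem h _)
    have hyB : y ∈ B := by
      by_contra h
      exact hfy (indicator_of_notMem h _)
    rw [indicator_of_mem hxA] at hfx ⊢
    rw [indicator_of_mem hyB] at hfy ⊢
    have hx0 : ∀ i, 0 < x i := fun i => hx i (mem_univ i)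
    have hy0 : ∀ i, 0 < y i := fun i => hy i (mem_univ i)
    have hmean : ∀ i, 0 < realMean (p i) lam (x i) (y i) := fun i =>
      realMean_pos _ hlam (hx0 i) (hy0 i)
    have hzC : (fun i => realMean (p i) lam (x i) (y i)) ∈ C :=
      ⟨x, hxA, y, hyB, fun i => (hx0 i).le, fun i => (hy0 i).le,
        funext fun i => abs_of_pos (hmean i)⟩
    rw [indicator_of_mem hzC]
    have hfx' : 0 < signInf f x := pos_iff_ne_zero.2 (ENNReal.coe_ne_zero.1 hfx)
    have hfy' : 0 < signInf f y := pos_iff_ne_zero.2 (ENNReal.coe_ne_zero.1 hfy)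
    refine (hα' lam hlam' _ _).trans
      ((hf.signInf x y (mul_pos hfx' hfy') lam hlam').trans (ENNReal.coe_le_coe.2 ?_))
    -- The `p i`-mean is at most the arithmetic mean since `p i ≤ 1`, and the density is antitone.
    refine hf.signInf_le_of_abs_le fun i => ?_
    rw [abs_of_pos (hmean i)]
    exact (realMean_le (hp i) hlam' (hx0 i).le (hy0 i).le).trans (le_abs_self _)

end LpBM

theorem theorem1 (n : ℕ) (p : Fin n → ℝ) (hp : ∀ i, p i ∈ Set.Icc (0 : ℝ) 1)
    (α : ℝ) (hα : -(((LpBM.sumInv p)⁻¹ : ENNReal) : EReal) ≤ (α : EReal))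
    (μ : MeasureTheory.Measure (Fin n → ℝ)) (hμ : LpBM.IsUnconditionalMeasure μ)
    (hμd : LpBM.HasAlphaConcaveDensity (α : EReal) μ)
    (A B : Set (Fin n → ℝ))
    (hA : LpBM.IsConvexBody A) (hAu : LpBM.IsUnconditionalSet A)
    (hB : LpBM.IsConvexBody B) (hBu : LpBM.IsUnconditionalSet B)
    (lam : ℝ) (hlam : lam ∈ Set.Icc (0 : ℝ) 1) :
    LpBM.powMean (LpBM.gammaExp p α) lam (μ A) (μ B) ≤
      μ (LpBM.pCombination (fun i => (p i : EReal)) lam A B) := by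
  rcases eq_or_lt_of_le hlam.1 with rfl | h0
  · exact (LpBM.powMean_weight_zero_le (LpBM.gammaExp_ne_top p α) _ _).trans (measure_mono
      (LpBM.subset_pCombination_zero p hA.convex hAu (interior_subset hB.zero_mem_interior)))
  rcases eq_or_lt_of_le hlam.2 with rfl | h1
  · exact (LpBM.powMean_weight_one_le (LpBM.gammaExp_ne_top p α) _ _).trans (measure_mono
      (LpBM.subset_pCombination_one p hB.convex hBu (interior_subset hA.zero_mem_interior)))
  exact LpBM.powMean_measure_le_of_mem_Ioo hp hα hμ hμd hA hAu hB hBu ⟨h0, h1⟩
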